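/- Let $a,b,\theta\in\mathbb{R}$ with $a,b\neq 0$ and $|\theta|<3b\pi$ (so that in particular $b>0$). Then all the series below converge absolutely, and the following three identities hold: \begin{align*} & b^{2}\pi \sum_{n=1}^{\infty} \frac{(-1)^{n} \sinh(n\theta/a)}{\sinh(bn\pi/a) \cosh^{2}(bn\pi/a)} + ab\pi \sum_{n=1}^{\infty} \frac{(-1)^{n} \sin(n\theta/b)}{\sinh(an\pi/b)} - a\theta \sum_{n=1}^{\infty} \frac{(-1)^{n} \cos((2n-1)\theta/(2b))}{\sinh((2n-1)a\pi/(2b))} \\ &\quad + a^{2}\pi \sum_{n=1}^{\infty} \frac{(-1)^{n} \sin((2n-1)\theta/(2b)) \cosh((2n-1)a\pi/(2b))}{\sinh^{2}((2n-1)a\pi/(2b))} + \frac{\theta b}{2} = 0,\\[1ex] & b^{2}\pi \sum_{n=1}^{\infty} \frac{(-1)^{n} \cosh((2n-1)\theta/(2a))}{\sinh((2n-1)b\pi/(2a)) \cosh^{2}((2n-1)b\pi/(2a))} + a\theta \sum_{n=1}^{\infty} \frac{(-1)^{n} \sin((2n-1)\theta/(2b))}{\cosh((2n-1)a\pi/(2b))}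 \\ &\quad + a^{2}\pi \sum_{n=1}^{\infty} \frac{(-1)^{n} \cos((2n-1)\theta/(2b)) \sinh((2n-1)a\pi/(2b))}{\cosh^{2}((2n-1)a\pi/(2b))} + ab\pi \sum_{n=1}^{\infty} \frac{(-1)^{n} \cos(n\theta/b)}{\cosh(an\pi/b)} + \frac{ab\pi}{2} = 0,\\[1ex] & b^{2}\pi^{2} \sum_{n=1}^{\infty} \frac{(-1)^{n} \cosh(n\theta/a)}{\sinh^{2}(n b\pi/a) \cosh(n b\pi/a)} + a \pi \theta \sum_{n=1}^{\infty} \frac{(-1)^{n} \sin(n\theta/b)}{\sinh(an\pi/b)} + a^{2} \pi^{2} \sum_{n=1}^{\infty} \frac{(-1)^{n} \cos(n\theta/b) \cosh(an\pi/b)}{\sinh^{2}(an\pi/b)} \\ &\quad + ab\pi^{2} \sum_{n=1}^{\infty} \frac{(-1)^{n-1} \cos((2n-1)\theta/(2b))}{\sinh((2n-1)a\pi/(2b))} + \frac{a^{2}\pi^{2}-5 b^{2}\pi^{2}+3 \theta^{2}}{12} = 0. \end{align*} -/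

import Mathlib

open Real

noncomputable section

namespace HypSeries

/-- The series `∑_{n ≥ 1} f n`; the index is shifted by one. -/
def sumFromOne (f : ℕ → ℝ) : ℝ := ∑' n : ℕ, f (n + 1)

/-- (Absolute) convergence of the series `∑_{n ≥ 1} f n`. -/
def ConvFromOne (f : ℕ → ℝ) : Prop := Summable fun n : ℕ => f (n + 1)

/-! The `n`-th terms of the series, used for `n ≥ 1` only. -/

def ceHyp (a b θ : ℝ) (n : ℕ) : ℝ :=
  (-1 : ℝ) ^ n * sinh (n * θ / a) / (sinh (b * n * π / a) * cosh (b * n * π / a) ^ 2)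

def sinOverSinh (a b θ : ℝ) (n : ℕ) : ℝ :=
  (-1 : ℝ) ^ n * sin (n * θ / b) / sinh (a * n * π / b)

def ceCosOdd (a b θ : ℝ) (n : ℕ) : ℝ :=
  (-1 : ℝ) ^ n * cos ((2 * (n : ℝ) - 1) * θ / (2 * b)) / sinh ((2 * (n : ℝ) - 1) * a * π / (2 * b))

def ceSinOdd (a b θ : ℝ) (n : ℕ) : ℝ :=
  (-1 : ℝ) ^ n * sin ((2 * (n : ℝ) - 1) * θ / (2 * b)) * cosh ((2 * (n : ℝ) - 1) * a * π / (2 * b)) /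
    sinh ((2 * (n : ℝ) - 1) * a * π / (2 * b)) ^ 2

def cfHyp (a b θ : ℝ) (n : ℕ) : ℝ :=
  (-1 : ℝ) ^ n * cosh ((2 * (n : ℝ) - 1) * θ / (2 * a)) /
    (sinh ((2 * (n : ℝ) - 1) * b * π / (2 * a)) * cosh ((2 * (n : ℝ) - 1) * b * π / (2 * a)) ^ 2)

def cfSinOdd (a b θ : ℝ) (n : ℕ) : ℝ :=
  (-1 : ℝ) ^ n * sin ((2 * (n : ℝ) - 1) * θ / (2 * b)) / cosh ((2 * (n : ℝ) - 1) * a * π / (2 * b))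

def cfCosOdd (a b θ : ℝ) (n : ℕ) : ℝ :=
  (-1 : ℝ) ^ n * cos ((2 * (n : ℝ) - 1) * θ / (2 * b)) * sinh ((2 * (n : ℝ) - 1) * a * π / (2 * b)) /
    cosh ((2 * (n : ℝ) - 1) * a * π / (2 * b)) ^ 2

def cfCos (a b θ : ℝ) (n : ℕ) : ℝ :=
  (-1 : ℝ) ^ n * cos (n * θ / b) / cosh (a * n * π / b)

def cgHyp (a b θ : ℝ) (n : ℕ) : ℝ :=
  (-1 : ℝ) ^ n * cosh (n * θ / a) / (sinh (n * b * π / a) ^ 2 * cosh (n * b * π / a))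

def cgCos (a b θ : ℝ) (n : ℕ) : ℝ :=
  (-1 : ℝ) ^ n * cos (n * θ / b) * cosh (a * n * π / b) / sinh (a * n * π / b) ^ 2

def cgCosOdd (a b θ : ℝ) (n : ℕ) : ℝ :=
  (-1 : ℝ) ^ (n - 1) * cos ((2 * (n : ℝ) - 1) * θ / (2 * b)) / sinh ((2 * (n : ℝ) - 1) * a * π / (2 * b))

end HypSeries

end

/-! Put `β = bπ/a` and `τ = θ/a`. Each identity says that the residues of one odd meromorphic
function add up to zero. The functions are `ceFun`, `cfFun` and `cgFun`, quotients `N / (A B² S)`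
with `N` equal to `sinh τz` or `cosh τz`, `{A, B} = {sinh βz, cosh βz}`, and `S` equal to `sin πz`
or `cos πz`.

The hypothesis on `θ` gives `|τ| < 3|β|`. The three hyperbolic factors below then dominate the
numerator in the real direction, while `S` grows in the imaginary direction. Away from the poles the
quotient is therefore exponentially small (`quotient_decay`), its integrals over suitable growing
circles tend to 0, and the residue theorem makes the total residue vanish
(`hasSum_residue_eq_zero`).

The zeros of `S` on the real axis produce the series of hyperbolic terms. On the imaginary axis, `A`
contributes simple poles and `B` double poles, whose residues are trigonometric in `θ/b`; a double
pole yields two series, one from `N'` and one from `S'`. The residue at 0 is the closed-form term.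
By oddness opposite poles have equal residues, so `quotient_residue_sum` takes the form `r₀ + 2(X +
E + O) = 0`. Clearing denominators gives the stated identities; convergence follows from comparison
with geometric series. -/

namespace HypSeries

open Filter Topology Asymptotics

/-! ### Residues at poles of order at most three, and the residue theorem on a circle -/

/-- `F` has at `p` an isolated singularity with a pole of order at most three and residue `c`. -/
def HasResidue (F : ℂ → ℂ) (p c : ℂ) : Prop :=
  ∃ c₂ c₃ : ℂ, Tendsto (fun z => (z - p) *
    (F z - (c₃ / (z - p) ^ 3 + c₂ / (z - p) ^ 2 + c / (z - p)))) (𝓝[≠] p) (𝓝 0)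

theorem tendsto_sub_self_nhdsNE (p : ℂ) : Tendsto (fun z : ℂ => z - p) (𝓝[≠] p) (𝓝 0) := by
  have : Tendsto (fun z : ℂ => z - p) (𝓝 p) (𝓝 (p - p)) := by
    exact (continuous_id.sub continuous_const).tendsto p
  rw [sub_self] at this
  exact this.mono_left nhdsWithin_le_nhds

theorem HasResidue.congr {F G : ℂ → ℂ} {p c : ℂ} (h : HasResidue F p c)
    (hFG : F =ᶠ[𝓝[≠] p] G) : HasResidue G p c := by
  obtain ⟨c₂, c₃, h⟩ := h
  refine ⟨c₂, c₃, h.congr' ?_⟩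
  filter_upwards [hFG] with z hz
  rw [hz]

theorem HasResidue.sub_continuousAt {F G : ℂ → ℂ} {p c : ℂ} (h : HasResidue F p c)
    (hG : ContinuousAt G p) : HasResidue (fun z => F z - G z) p c := by
  obtain ⟨c₂, c₃, h⟩ := h
  refine ⟨c₂, c₃, ?_⟩
  have h2 := (tendsto_sub_self_nhdsNE p).mul (hG.tendsto.mono_left nhdsWithin_le_nhds)
  have h3 := h.sub h2
  rw [zero_mul, sub_zero] at h3
  refine h3.congr fun z => ?_
  ring

theorem HasResidue.neg_of_odd {F : ℂ → ℂ} {p c : ℂ} (h : HasResidue F p c)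
    (hodd : ∀ z, F (-z) = -F z) : HasResidue F (-p) c := by
  obtain ⟨c₂, c₃, h⟩ := h
  -- Under `z ↦ -z` and the overall sign of an odd function, the odd powers of `1/(z - p)` keep
  -- their coefficients and the even power changes sign.
  refine ⟨-c₂, c₃, ?_⟩
  have hneg : Tendsto (fun z : ℂ => -z) (𝓝[≠] (-p)) (𝓝[≠] p) := by
    refine tendsto_nhdsWithin_iff.2 ⟨?_, ?_⟩
    · have : Tendsto (fun z : ℂ => -z) (𝓝 (-p)) (𝓝 (- -p)) := continuous_neg.tendsto _
      rw [neg_neg] at this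
      exact this.mono_left nhdsWithin_le_nhds
    · filter_upwards [self_mem_nhdsWithin] with z hz hz'
      exact hz (by rw [← hz', neg_neg]; rfl)
  refine (h.comp hneg).congr fun z => ?_
  simp only [Function.comp_apply, hodd]
  have e : -z - p = -(z - -p) := by ring
  rw [e, Odd.neg_pow (by decide : Odd 3), neg_sq, div_neg, div_neg]
  ring

theorem hasResidue_of_tendsto {F : ℂ → ℂ} {p c : ℂ}
    (h : Tendsto (fun z => (z - p) * F z) (𝓝[≠] p) (𝓝 c)) : HasResidue F p c := by
  refine ⟨0, 0, ?_⟩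
  have h2 := h.sub_const c
  rw [sub_self] at h2
  refine h2.congr' ?_
  filter_upwards [self_mem_nhdsWithin] with z hz
  have hz' : z - p ≠ 0 := sub_ne_zero.2 hz
  field_simp
  ring

/-- The higher negative powers have single-valued primitives, so only `c / (z - p)` contributes. -/
theorem circleIntegral_pole (p : ℂ) {R : ℝ} (hp : ‖p‖ < R) (c c₂ c₃ : ℂ) :
    (∮ z in C(0, R), (c₃ / (z - p) ^ 3 + c₂ / (z - p) ^ 2 + c / (z - p))) = 2 * π * Complex.I * c := by
  have hne : ∀ z ∈ Metric.sphere (0 : ℂ) R, z - p ≠ 0 := by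
    intro z hz h0
    rw [sub_eq_zero] at h0
    subst h0
    simp at hz
    exact hp.ne hz
  have hR : 0 ≤ R := (norm_nonneg p).trans hp.le
  have hci : ∀ (k : ℕ) (d : ℂ), CircleIntegrable (fun z => d / (z - p) ^ k) 0 R := fun k d =>
    ContinuousOn.circleIntegrable hR
      (continuousOn_const.div ((continuous_id.sub continuous_const).pow k).continuousOn
        fun z hz => pow_ne_zero _ (hne z hz))
  have hz : ∀ (k : ℕ) (d : ℂ), k ≠ 1 → (∮ z in C(0, R), d / (z - p) ^ k) = 0 := by
    intro k d hk
    have := circleIntegral.integral_sub_zpow_of_ne (n := -(k : ℤ)) (by omega) 0 p R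
    simp only [zpow_neg, zpow_natCast] at this
    simp only [div_eq_mul_inv]
    rw [circleIntegral.integral_const_mul, this, mul_zero]
  have h1 : (∮ z in C(0, R), c / (z - p)) = 2 * π * Complex.I * c := by
    simp only [div_eq_mul_inv]
    rw [circleIntegral.integral_const_mul, circleIntegral.integral_sub_inv_of_mem_ball (by simpa)]
    ring
  have hci1 : CircleIntegrable (fun z => c / (z - p)) 0 R := by simpa using hci 1 c
  have hci32 : CircleIntegrable (fun z => c₃ / (z - p) ^ 3 + c₂ / (z - p) ^ 2) 0 R :=
    (hci 3 c₃).add (hci 2 c₂)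
  rw [circleIntegral.integral_add hci32 hci1,
    circleIntegral.integral_add (hci 3 c₃) (hci 2 c₂), hz 3 _ (by decide), hz 2 _ (by decide), h1]
  ring

theorem differentiableAt_pole {p z : ℂ} (hz : z ≠ p) (c c₂ c₃ : ℂ) :
    DifferentiableAt ℂ (fun z => c₃ / (z - p) ^ 3 + c₂ / (z - p) ^ 2 + c / (z - p)) z := by
  have : z - p ≠ 0 := sub_ne_zero.2 hz
  fun_prop (disch := first | assumption | exact pow_ne_zero _ this)

/-- The residue theorem for a circle around the origin. -/
theorem circleIntegral_eq_sum_residue {ι : Type*} (q c : ι → ℂ) (hq : Function.Injective q)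
    {R : ℝ} (hR : 0 < R) (s : Finset ι) :
    ∀ F : ℂ → ℂ, (∀ i ∈ s, ‖q i‖ < R) → (∀ i ∈ s, HasResidue F (q i) (c i)) →
      (∀ z, ‖z‖ ≤ R → (∀ i ∈ s, z ≠ q i) → DifferentiableAt ℂ F z) →
      (∮ z in C(0, R), F z) = 2 * π * Complex.I * ∑ i ∈ s, c i := by
  induction s using Finset.cons_induction with
  | empty =>
    intro F _ _ hF
    rw [Finset.sum_empty, mul_zero]
    refine Complex.circleIntegral_eq_zero_of_differentiable_on_off_countable hR.le
      Set.countable_empty (fun z hz => ?_) (fun z hz => ?_)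
    · exact (hF z (by simpa using hz) (by simp)).continuousAt.continuousWithinAt
    · exact hF z (by simpa using (Metric.ball_subset_closedBall hz.1)) (by simp)
  | cons i s his ih =>
    intro F hlt hres hF
    obtain ⟨c₂, c₃, hi⟩ := hres i (Finset.mem_cons_self i s)
    set p := q i with hp
    have hpR : ‖p‖ < R := hlt i (Finset.mem_cons_self i s)
    set P : ℂ → ℂ := fun z => c₃ / (z - p) ^ 3 + c₂ / (z - p) ^ 2 + c i / (z - p) with hP
    set G₀ : ℂ → ℂ := fun z => F z - P z with hG₀
    -- Subtracting the principal part at `p` leaves a removable singularity: `HasResidue` says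
    -- exactly that `(z - p) * G₀ z → 0`, which is Riemann's criterion. The filled-in `G` has one
    -- pole fewer, and the induction is over all functions, so it applies to `G`.
    set G : ℂ → ℂ := Function.update G₀ p (limUnder (𝓝[≠] p) G₀) with hG
    have hGne : ∀ z, z ≠ p → G z = G₀ z := fun z hz => Function.update_of_ne hz _ _
    have hGev : ∀ z, z ≠ p → G =ᶠ[𝓝 z] G₀ := fun z hz => by
      filter_upwards [isOpen_ne.mem_nhds hz] with w hw using hGne w hw
    have hdiff : ∀ z, ‖z‖ ≤ R → (∀ j ∈ s, z ≠ q j) → z ≠ p → DifferentiableAt ℂ G₀ z := by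
      intro z hzR hz hzp
      refine (hF z hzR ?_).sub (differentiableAt_pole hzp _ _ _)
      intro j hj
      rcases Finset.mem_cons.1 hj with rfl | hj
      exacts [hzp, hz j hj]
    have hGp : DifferentiableAt ℂ G p := by
      set U : Set ℂ := Metric.ball 0 R ∩ (⋂ j ∈ s, {q j}ᶜ) with hU
      have hUo : IsOpen U := Metric.isOpen_ball.inter
        (isOpen_biInter_finset fun j _ => isOpen_compl_singleton)
      have hpU : p ∈ U := by
        refine ⟨by simpa using hpR, ?_⟩
        simp only [Set.mem_iInter]
        intro j hj h
        exact his (hq (h : q i = q j) ▸ hj)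
      refine (Complex.differentiableOn_update_limUnder_of_isLittleO (hUo.mem_nhds hpU)
        ?_ ?_).differentiableAt (hUo.mem_nhds hpU)
      · rintro z ⟨⟨hz1, hz2⟩, hzp⟩
        refine (hdiff z (by simpa using (Metric.ball_subset_closedBall hz1)) ?_ hzp).differentiableWithinAt
        intro j hj
        simp only [Set.mem_iInter] at hz2
        exact hz2 j hj
      · rw [isLittleO_iff_tendsto']
        · have h2 := (tendsto_sub_self_nhdsNE p).mul_const (G₀ p)
          have h3 := hi.sub h2
          rw [zero_mul, sub_zero] at h3
          refine h3.congr fun z => ?_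
          rw [div_inv_eq_mul]
          simp only [hG₀, hP]
          ring
        · filter_upwards [self_mem_nhdsWithin] with z hz h0
          exact absurd (sub_eq_zero.1 (inv_eq_zero.1 h0)) hz
    have key := ih G (fun j hj => hlt j (Finset.mem_cons_of_mem hj)) (fun j hj => ?_)
      (fun z hzR hz => ?_)
    · have hsph : ∀ z ∈ Metric.sphere (0 : ℂ) R, z ≠ p := by
        rintro z hz rfl
        simp at hz
        exact hpR.ne hz
      have hsph2 : ∀ z ∈ Metric.sphere (0 : ℂ) R, ∀ j ∈ Finset.cons i s his, z ≠ q j := by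
        rintro z hz j hj rfl
        simp at hz
        exact (hlt j hj).ne hz
      have hcong : (∮ z in C(0, R), F z) = ∮ z in C(0, R), (G z + P z) := by
        refine circleIntegral.integral_congr hR.le fun z hz => ?_
        simp only [hGne z (hsph z hz), hG₀]
        ring
      have hGint : CircleIntegrable G 0 R := by
        refine ContinuousOn.circleIntegrable hR.le fun z hz => ContinuousAt.continuousWithinAt ?_
        have := (hdiff z (by simpa using (show z ∈ Metric.closedBall (0:ℂ) R from Metric.sphere_subset_closedBall hz))
          (fun j hj => hsph2 z hz j (Finset.mem_cons_of_mem hj)) (hsph z hz)).continuousAt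
        exact this.congr (hGev z (hsph z hz)).symm
      have hPint : CircleIntegrable P 0 R :=
        ContinuousOn.circleIntegrable hR.le fun z hz =>
          (differentiableAt_pole (hsph z hz) _ _ _).continuousAt.continuousWithinAt
      rw [hcong, circleIntegral.integral_add hGint hPint, key, circleIntegral_pole p hpR,
        Finset.sum_cons]
      ring
    · have hne : q j ≠ p := fun h => his (hq h ▸ hj)
      refine ((hres j (Finset.mem_cons_of_mem hj)).sub_continuousAt
        (differentiableAt_pole hne (c i) c₂ c₃).continuousAt).congr ?_
      exact (hGev _ hne).symm.filter_mono nhdsWithin_le_nhds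
    · by_cases hzp : z = p
      · rw [hzp]; exact hGp
      · exact (hdiff z hzR hz hzp).congr_of_eventuallyEq (hGev z hzp)

/-! ### Exponential bounds for sine and cosine away from their zeros -/

theorem exp_abs_le_two_mul_cosh (y : ℝ) : exp |y| ≤ 2 * cosh y := by
  rw [← cosh_abs, cosh_eq]
  linarith [exp_pos (-|y|)]

theorem exp_abs_mul_le_abs_sinh {δ y : ℝ} (hy : δ ≤ |y|) :
    (1 - exp (-(2 * δ))) / 2 * exp |y| ≤ |sinh y| := by
  have h1 : exp (-|y|) = exp |y| * exp (-(2 * |y|)) := by rw [← exp_add]; ring_nf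
  have h2 : exp (-(2 * |y|)) ≤ exp (-(2 * δ)) := exp_le_exp.2 (by linarith)
  have h3 : |sinh y| = (exp |y| - exp (-|y|)) / 2 := by
    rw [abs_sinh, sinh_eq]
  rw [h3, h1]
  nlinarith [exp_pos |y|]

theorem norm_complex_cos_le (w : ℂ) : ‖Complex.cos w‖ ≤ exp |w.im| := by
  rw [Complex.cos, norm_div, Complex.norm_two]
  have h := norm_add_le (Complex.exp (w * Complex.I)) (Complex.exp (-w * Complex.I))
  rw [Complex.norm_exp, Complex.norm_exp] at h
  simp only [Complex.mul_re, Complex.neg_re, Complex.neg_im, Complex.I_re, Complex.I_im, mul_zero,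
    mul_one, zero_sub, neg_neg] at h
  have h1 : exp (-w.im) ≤ exp |w.im| := exp_le_exp.2 (neg_le_abs _)
  have h2 : exp w.im ≤ exp |w.im| := exp_le_exp.2 (le_abs_self _)
  linarith

theorem norm_complex_sin_le (w : ℂ) : ‖Complex.sin w‖ ≤ exp |w.im| := by
  have := norm_complex_cos_le (w - π / 2)
  rw [Complex.cos_sub_pi_div_two] at this
  simpa using this

/-- From `|sin w|² = sin² x cosh² y + cos² x sinh² y` with `w = x + iy`. If `|y| ≥ δ/2`, then `|sin
w| ≥ |sinh y|` suffices. Otherwise `x` is at least `δ/2` away from the nearest multiple of `π`, and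
Jordan's inequality bounds `|sin x|` below. -/
theorem norm_complex_sin_lower {δ : ℝ} (hδ : 0 < δ) :
    ∃ c > 0, ∀ w : ℂ, (∀ k : ℤ, δ ≤ ‖w - k * π‖) → c * exp |w.im| ≤ ‖Complex.sin w‖ := by
  have hE : exp (-(2 * (δ / 2))) < 1 := by rw [exp_lt_one_iff]; linarith
  refine ⟨min ((1 - exp (-(2 * (δ / 2)))) / 2) (δ / (2 * π)), ?_, fun w hw => ?_⟩
  · have := pi_pos
    exact lt_min (by linarith) (by positivity)
  · have hre : (Complex.sin w).re = sin w.re * cosh w.im := by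
      rw [Complex.sin_eq]; simp [← Complex.ofReal_sin, ← Complex.ofReal_cos, ← Complex.ofReal_sinh, ← Complex.ofReal_cosh]
    have him : (Complex.sin w).im = cos w.re * sinh w.im := by
      rw [Complex.sin_eq]; simp [← Complex.ofReal_sin, ← Complex.ofReal_cos, ← Complex.ofReal_sinh, ← Complex.ofReal_cosh]
    rcases le_or_gt (δ / 2) |w.im| with hy | hy
    · refine le_trans ?_ ((exp_abs_mul_le_abs_sinh hy).trans ?_)
      · exact mul_le_mul_of_nonneg_right (min_le_left _ _) (exp_pos _).le
      · rw [← abs_norm (Complex.sin w), ← sq_le_sq, Complex.sq_norm, Complex.normSq_apply, hre, him]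
        nlinarith [sq_nonneg (sin w.re), sin_sq_add_cos_sq w.re, cosh_sq w.im]
    · refine le_trans (mul_le_mul_of_nonneg_right (min_le_right _ _) (exp_pos _).le) ?_
      refine le_trans ?_ (Complex.abs_re_le_norm _)
      rw [hre, abs_mul, abs_of_pos (cosh_pos _)]
      set k : ℤ := round (w.re / π) with hk
      have hk1 : |w.re - k * π| ≤ π / 2 := by
        have := abs_sub_round (w.re / π)
        have e : w.re - k * π = (w.re / π - k) * π := by field_simp
        rw [e, abs_mul, abs_of_pos pi_pos]
        nlinarith [pi_pos]
      have hk2 : δ / 2 ≤ |w.re - k * π| := by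
        have h1 := hw k
        have h2 := Complex.norm_le_abs_re_add_abs_im (w - k * π)
        simp at h2
        linarith
      have hk3 : |sin w.re| = |sin (w.re - k * π)| := by
        rw [Real.sin_sub_int_mul_pi, abs_mul, abs_zpow]; simp
      have hk4 := mul_abs_le_abs_sin hk1
      rw [hk3]
      have h5 : δ / π ≤ |sin (w.re - k * π)| := by
        refine le_trans ?_ hk4
        have : 2 / π * (δ / 2) ≤ 2 / π * |w.re - k * π| :=
          mul_le_mul_of_nonneg_left hk2 (by positivity)
        refine le_trans (le_of_eq ?_) this
        field_simp
      have h6 := exp_abs_le_two_mul_cosh w.im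
      calc δ / (2 * π) * exp |w.im| = δ / π * (exp |w.im| / 2) := by field_simp
        _ ≤ _ := mul_le_mul h5 (by linarith) (by positivity) (abs_nonneg _)

/-- In `sin 2w = 2 sin w cos w` the product is bounded below by a multiple of `exp |Im w| ^ 2` and
each factor above by `exp |Im w|`, so neither factor can be small. -/
theorem norm_complex_sin_cos_lower {δ : ℝ} (hδ : 0 < δ) :
    ∃ c > 0, ∀ w : ℂ, (∀ k : ℤ, δ ≤ ‖w - k * (π / 2)‖) →
      c * exp |w.im| ≤ ‖Complex.sin w‖ ∧ c * exp |w.im| ≤ ‖Complex.cos w‖ := by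
  obtain ⟨c, hc, h⟩ := norm_complex_sin_lower (δ := 2 * δ) (by linarith)
  refine ⟨c / 2, by linarith, fun w hw => ?_⟩
  have h1 := h (2 * w) fun k => by
    have e : 2 * w - k * π = 2 * (w - k * (π / 2)) := by ring
    rw [e, norm_mul, Complex.norm_two]
    linarith [hw k]
  rw [Complex.sin_two_mul, norm_mul, norm_mul, Complex.norm_two] at h1
  have e : exp |(2 * w).im| = exp |w.im| * exp |w.im| := by
    rw [← exp_add]; simp [abs_mul]; ring
  rw [e] at h1
  have hE := exp_pos |w.im|
  have hs := norm_complex_sin_le w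
  have hcs := norm_complex_cos_le w
  constructor
  · refine le_of_mul_le_mul_right ?_ hE
    nlinarith [norm_nonneg (Complex.sin w)]
  · refine le_of_mul_le_mul_right ?_ hE
    nlinarith [norm_nonneg (Complex.cos w)]

/-! ### Circles avoiding the poles, and vanishing of the total residue -/

/-- The points at distance at least `δ` from the half-integers and from `ℤ d i`. -/
def FarFromGrid (d δ : ℝ) (z : ℂ) : Prop :=
  (∀ k : ℤ, δ ≤ ‖z - k / 2‖) ∧ ∀ k : ℤ, δ ≤ ‖z - k * d * Complex.I‖

/-- The radius `N + 1/8` is far from the half-integers. If it lies within `δ` of some `m * e`,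
shifting it by `2δ` escapes that multiple; `4δ ≤ e` keeps it away from the next one, and `δ ≤ 1/8`
keeps it below `N + 3/8`. -/
theorem exists_radius_gap {e : ℝ} (he : 0 < e) :
    ∃ δ > 0, ∀ N : ℕ, ∃ R : ℝ, (N : ℝ) < R ∧ (∀ m : ℕ, δ ≤ |R - m / 2|) ∧
      ∀ m : ℕ, δ ≤ |R - m * e| := by
  refine ⟨min (1 / 8) (e / 4), lt_min (by norm_num) (by linarith), fun N => ?_⟩
  set δ := min (1 / 8) (e / 4) with hδ
  have h1 : δ ≤ 1 / 8 := min_le_left _ _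
  have h2 : δ ≤ e / 4 := min_le_right _ _
  have h0 : 0 < δ := lt_min (by norm_num) (by linarith)
  have hhalf : ∀ x : ℝ, (N : ℝ) + 1 / 8 ≤ x → x ≤ N + 3 / 8 → ∀ m : ℕ, δ ≤ |x - m / 2| := by
    intro x hx1 hx2 m
    rcases Nat.lt_or_ge (2 * N) m with h | h
    · have : (2 * N + 1 : ℝ) ≤ m := by exact_mod_cast h
      exact le_trans (by linarith) (neg_le_abs _)
    · have : (m : ℝ) ≤ 2 * N := by exact_mod_cast h
      exact le_trans (by linarith) (le_abs_self _)
  by_cases hx : ∀ m : ℕ, δ ≤ |((N : ℝ) + 1 / 8) - m * e|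
  · exact ⟨N + 1 / 8, by linarith, hhalf _ le_rfl (by linarith), hx⟩
  · push Not at hx
    obtain ⟨m, hm⟩ := hx
    rw [abs_lt] at hm
    refine ⟨N + 1 / 8 + 2 * δ, by linarith, hhalf _ (by linarith) (by linarith), fun j => ?_⟩
    rcases Nat.lt_or_ge m j with h | h
    · have : (m + 1 : ℝ) ≤ j := by exact_mod_cast h
      have : (m + 1 : ℝ) * e ≤ j * e := mul_le_mul_of_nonneg_right this he.le
      exact le_trans (by linarith) (neg_le_abs _)
    · have : (j : ℝ) ≤ m := by exact_mod_cast h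
      have : (j : ℝ) * e ≤ m * e := mul_le_mul_of_nonneg_right this he.le
      exact le_trans (by linarith) (le_abs_self _)

theorem exists_radius_farFromGrid {d : ℝ} (hd : d ≠ 0) :
    ∃ δ > 0, ∀ N : ℕ, ∃ R : ℝ, (N : ℝ) < R ∧ ∀ z : ℂ, ‖z‖ = R → FarFromGrid d δ z := by
  obtain ⟨δ, hδ, h⟩ := exists_radius_gap (abs_pos.2 hd)
  refine ⟨δ, hδ, fun N => ?_⟩
  obtain ⟨R, hN, h1, h2⟩ := h N
  refine ⟨R, hN, fun z hz => ⟨fun k => ?_, fun k => ?_⟩⟩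
  · refine (h1 k.natAbs).trans ?_
    -- By the reverse triangle inequality only the moduli of the grid points matter, which reduces
    -- the plane problem to the radius.
    have := abs_norm_sub_norm_le z (k / 2)
    rw [hz] at this
    simpa [Nat.cast_natAbs] using this
  · refine (h2 k.natAbs).trans ?_
    have := abs_norm_sub_norm_le z (k * d * Complex.I)
    rw [hz] at this
    simpa [Nat.cast_natAbs] using this

/-- If `F` decays exponentially on a sequence of circles tending to infinity that avoid the poles,
then the residues add up to zero. -/
theorem hasSum_residue_eq_zero {ι : Type*} {q c : ι → ℂ} (hq : Function.Injective q) {F : ℂ → ℂ}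
    (hfin : ∀ R : ℝ, {i | ‖q i‖ < R}.Finite)
    (hres : ∀ i, HasResidue F (q i) (c i)) (hF : ∀ z, (∀ i, z ≠ q i) → DifferentiableAt ℂ F z)
    {C κ : ℝ} (hκ : 0 < κ)
    (hdec : ∀ N : ℕ, ∃ R : ℝ, (N : ℝ) < R ∧ (∀ i, ‖q i‖ ≠ R) ∧
      ∀ z, ‖z‖ = R → ‖F z‖ ≤ C * exp (-κ * R)) {T : ℂ} (hT : HasSum c T) : T = 0 := by
  choose R hNR hqR hbound using hdec
  have hRpos : ∀ N, 0 < R N := fun N => (Nat.cast_nonneg N).trans_lt (hNR N)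
  have hR : Tendsto R atTop atTop :=
    tendsto_atTop_mono (fun N => (hNR N).le) tendsto_natCast_atTop_atTop
  set s : ℕ → Finset ι := fun N => (hfin (R N)).toFinset with hs
  -- The discs exhaust the index set, and `HasSum` is unconditional, so the sums over the poles
  -- inside them converge to `T`.
  have hsT : Tendsto s atTop atTop := by
    refine tendsto_atTop.2 fun t => ?_
    have : ∀ᶠ N in atTop, ∀ i ∈ t, ‖q i‖ < R N :=
      (Filter.eventually_all_finset t).2 fun i _ => hR.eventually_gt_atTop _
    filter_upwards [this] with N hN i hi
    simpa [hs] using hN i hi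
  have hint : ∀ N, (∮ z in C(0, R N), F z) = 2 * π * Complex.I * ∑ i ∈ s N, c i := by
    intro N
    refine circleIntegral_eq_sum_residue q c hq (hRpos N) (s N) F (fun i hi => by simpa [hs] using hi)
      (fun i _ => hres i) (fun z hz hzs => hF z ?_)
    rintro i rfl
    exact hzs i (by simpa [hs] using lt_of_le_of_ne hz (hqR N i)) rfl
  have h1 : Tendsto (fun N => 2 * π * Complex.I * ∑ i ∈ s N, c i) atTop
      (𝓝 (2 * π * Complex.I * T)) := (hT.comp hsT).const_mul _
  have h2 : Tendsto (fun N => 2 * π * Complex.I * ∑ i ∈ s N, c i) atTop (𝓝 0) := by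
    have hlim : Tendsto (fun N => 2 * π * C * (R N * exp (-κ * R N))) atTop (𝓝 0) := by
      have := (tendsto_rpow_mul_exp_neg_mul_atTop_nhds_zero 1 κ hκ).comp hR
      simpa using this.const_mul (2 * π * C)
    refine squeeze_zero_norm (fun N => ?_) hlim
    rw [← hint N]
    refine (circleIntegral.norm_integral_le_of_norm_le_const (hRpos N).le
      (fun z hz => hbound N z (by simpa using hz))).trans (le_of_eq ?_)
    ring
  have h3 := tendsto_nhds_unique h1 h2
  have : (2 * π * Complex.I : ℂ) ≠ 0 := by simp [pi_ne_zero]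
  exact (mul_eq_zero.1 h3).resolve_left this

/-- The residue sum of an odd function with poles at `0`, at `±(n + m / 2)` and at `±(k + 1) d i`. -/
theorem odd_residue_sum {F : ℂ → ℂ} {d : ℝ} (hd : d ≠ 0) {m : ℕ} (hm : 0 < m)
    (hodd : ∀ z, F (-z) = -F z) {r₀ : ℂ} {rx ry : ℕ → ℂ} (h0 : HasResidue F 0 r₀)
    (hx : ∀ n : ℕ, HasResidue F (n + m / 2) (rx n))
    (hy : ∀ k : ℕ, HasResidue F ((k + 1) * d * Complex.I) (ry k))
    (hF : ∀ z : ℂ, z ≠ 0 → (∀ n : ℕ, z ≠ n + m / 2 ∧ z ≠ -(n + m / 2)) →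
      (∀ k : ℕ, z ≠ (k + 1) * d * Complex.I ∧ z ≠ -((k + 1) * d * Complex.I)) →
      DifferentiableAt ℂ F z)
    (hdec : ∀ δ > 0, ∃ C κ : ℝ, 0 < κ ∧ ∀ z, FarFromGrid d δ z → ‖F z‖ ≤ C * exp (-κ * ‖z‖))
    {X Y : ℂ} (hX : HasSum rx X) (hY : HasSum ry Y) : r₀ + 2 * (X + Y) = 0 := by
  -- `q₁` lists one pole from each pair `±p`; the full list is 0, `q₁` and `-q₁`, with the same
  -- residues on the last two by oddness.
  set q₁ : ℕ ⊕ ℕ → ℂ := Sum.elim (fun n => (n : ℂ) + m / 2) fun k => (k + 1) * d * Complex.I with hq₁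
  set q : Unit ⊕ ((ℕ ⊕ ℕ) ⊕ (ℕ ⊕ ℕ)) → ℂ := Sum.elim (fun _ => 0) (Sum.elim q₁ (-q₁)) with hq
  set c : Unit ⊕ ((ℕ ⊕ ℕ) ⊕ (ℕ ⊕ ℕ)) → ℂ :=
    Sum.elim (fun _ => r₀) (Sum.elim (Sum.elim rx ry) (Sum.elim rx ry)) with hc
  have hm' : (0 : ℝ) < m := by exact_mod_cast hm
  have hxr : ∀ n : ℕ, (n : ℂ) + m / 2 = ((n + m / 2 : ℝ) : ℂ) := fun n => by push_cast; rfl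
  have hyr : ∀ k : ℕ, ((k : ℂ) + 1) * d * Complex.I = (((k + 1) * d : ℝ) : ℂ) * Complex.I :=
    fun n => by push_cast; rfl
  have hyne : ∀ k : ℕ, ((k : ℝ) + 1) * d ≠ 0 := fun k => mul_ne_zero (by positivity) hd
  have hxpos : ∀ n : ℕ, (0 : ℝ) < n + m / 2 := fun n => by positivity
  have hxinj : ∀ n n' : ℕ, (n + m / 2 : ℝ) = n' + m / 2 → n = n' := fun n n' h => by
    exact_mod_cast add_right_cancel h
  have hyinj : ∀ n n' : ℕ, ((n : ℝ) + 1) * d = (n' + 1) * d → n = n' := fun n n' h => by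
    exact_mod_cast add_right_cancel (mul_right_cancel₀ hd h)
  have hyneg : ∀ n n' : ℕ, ((n : ℝ) + 1) * d ≠ -((n' + 1) * d) := fun n n' h => by
    have h1 : ((n : ℝ) + n' + 2) * d = 0 := by linarith
    exact mul_ne_zero (by positivity) hd h1
  have hinj : Function.Injective q := by
    rintro (_ | (n | k) | (n | k)) (_ | (n' | k') | (n' | k')) h <;>
      simp only [hq, hq₁, Sum.elim_inl, Sum.elim_inr, Pi.neg_apply, hxr, hyr, Complex.ext_iff,
        Complex.zero_re, Complex.zero_im, Complex.neg_re, Complex.neg_im, Complex.ofReal_re,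
        Complex.ofReal_im, Complex.mul_re, Complex.mul_im, Complex.I_re, Complex.I_im, mul_zero,
        mul_one, add_zero, sub_self, neg_zero] at h
    all_goals first
      | rfl
      | (have e := hxinj _ _ h.1; rw [e])
      | (have e := hxinj _ _ (neg_injective h.1); rw [e])
      | (have e := hyinj _ _ h.2; rw [e])
      | (have e := hyinj _ _ (neg_injective h.2); rw [e])
      | (exfalso; linarith [hxpos ‹ℕ›, h.1])
      | exact absurd h.2 (hyne _)
      | exact absurd h.2 (hyne _).symm
      | exact absurd h.2 (hyneg _ _)
      | exact absurd h.2.symm (hyneg _ _)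
      | exact absurd h.2 (neg_ne_zero.2 (hyne _))
      | exact absurd h.2.symm (neg_ne_zero.2 (hyne _))
  have hfin₁ : ∀ R : ℝ, {i | ‖q₁ i‖ < R}.Finite := by
    intro R
    have hA : {n : ℕ | ‖q₁ (Sum.inl n)‖ < R}.Finite := by
      refine (Set.finite_Iio ⌈R⌉₊).subset fun n hn => ?_
      simp only [hq₁, Sum.elim_inl, hxr, Complex.norm_real, Set.mem_ofPred_eq] at hn
      have := (le_abs_self _).trans_lt hn
      exact Nat.lt_ceil.2 (by linarith)
    have hB : {k : ℕ | ‖q₁ (Sum.inr k)‖ < R}.Finite := by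
      refine (Set.finite_Iio ⌈R / |d|⌉₊).subset fun n hn => ?_
      simp only [hq₁, Sum.elim_inr, hyr, norm_mul, Complex.norm_I, mul_one, Complex.norm_real,
        Set.mem_ofPred_eq, Real.norm_eq_abs] at hn
      refine Nat.lt_ceil.2 ((lt_div_iff₀ (abs_pos.2 hd)).2 ?_)
      rw [abs_of_pos (by positivity : (0 : ℝ) < n + 1)] at hn
      linarith [abs_pos.2 hd]
    refine ((hA.image Sum.inl).union (hB.image Sum.inr)).subset ?_
    rintro (n | k) h
    · exact Or.inl ⟨n, h, rfl⟩
    · exact Or.inr ⟨k, h, rfl⟩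
  have hfin : ∀ R : ℝ, {i | ‖q i‖ < R}.Finite := by
    intro R
    refine (((Set.finite_univ (α := Unit)).image Sum.inl).union
      (((hfin₁ R).image (Sum.inr ∘ Sum.inl)).union ((hfin₁ R).image (Sum.inr ∘ Sum.inr)))).subset ?_
    rintro (_ | i | i) h
    · exact Or.inl ⟨_, trivial, rfl⟩
    · exact Or.inr (Or.inl ⟨i, h, rfl⟩)
    · refine Or.inr (Or.inr ⟨i, ?_, rfl⟩)
      simpa [hq] using h
  have hres₁ : ∀ i, HasResidue F (q₁ i) (Sum.elim rx ry i) := by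
    rintro (n | k)
    exacts [hx n, hy k]
  have hres : ∀ i, HasResidue F (q i) (c i) := by
    rintro (_ | i | i)
    exacts [h0, hres₁ i, (hres₁ i).neg_of_odd hodd]
  have hdiff : ∀ z, (∀ i, z ≠ q i) → DifferentiableAt ℂ F z := by
    intro z hz
    refine hF z (hz (Sum.inl ())) (fun n => ⟨hz (Sum.inr (Sum.inl (Sum.inl n))), hz (Sum.inr (Sum.inr (Sum.inl n)))⟩)
      (fun n => ⟨hz (Sum.inr (Sum.inl (Sum.inr n))), hz (Sum.inr (Sum.inr (Sum.inr n)))⟩)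
  obtain ⟨δ, hδ, hrad⟩ := exists_radius_farFromGrid hd
  obtain ⟨C, κ, hκ, hb⟩ := hdec δ hδ
  have hpole₁ : ∀ i, ¬ FarFromGrid d δ (q₁ i) := by
    rintro (n | k) ⟨g1, g2⟩
    · have := g1 (2 * n + m)
      simp only [hq₁, Sum.elim_inl] at this
      have e : (n : ℂ) + m / 2 - ((2 * n + m : ℤ) : ℂ) / 2 = 0 := by push_cast; ring
      rw [e, norm_zero] at this
      linarith
    · have := g2 (k + 1)
      simp only [hq₁, Sum.elim_inr] at this
      have e : ((k : ℂ) + 1) * d * Complex.I - ((k + 1 : ℤ) : ℂ) * d * Complex.I = 0 := by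
        push_cast; ring
      rw [e, norm_zero] at this
      linarith
  have hT : HasSum c (r₀ + ((X + Y) + (X + Y))) := by
    have h1 : HasSum (Sum.elim rx ry) (X + Y) := HasSum.sum hX hY
    refine HasSum.sum ?_ (HasSum.sum h1 h1)
    exact hasSum_unique _
  have := hasSum_residue_eq_zero hinj hfin hres hdiff (C := C) hκ (fun N => ?_) hT
  · rw [← this]; ring
  · obtain ⟨R, hNR, hfar⟩ := hrad N
    refine ⟨R, hNR, ?_, fun z hz => ?_⟩
    · rintro (_ | i | i) h
      · simp only [hq, Sum.elim_inl, norm_zero] at h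
        exact ((Nat.cast_nonneg N).trans_lt hNR).ne h
      · exact hpole₁ i (hfar _ h)
      · exact hpole₁ i (hfar _ (by simpa [hq] using h))
    · rw [← hz]
      exact hb z (hfar z hz)

/-! ### Exponential decay of the quotients -/

/-- The rotation `w = βzi` turns `sinh` and `cosh` into `sin` and `cos`, and real parts into
imaginary parts up to the factor `β`. -/
theorem norm_complex_sinh_cosh_lower {δ β : ℝ} (hδ : 0 < δ) (hβ : β ≠ 0) :
    ∃ c > 0, ∀ z : ℂ, (∀ k : ℤ, δ ≤ ‖z - k * (π / (2 * β) : ℝ) * Complex.I‖) →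
      c * exp (|β| * |z.re|) ≤ ‖Complex.sinh (β * z)‖ ∧
      c * exp (|β| * |z.re|) ≤ ‖Complex.cosh (β * z)‖ := by
  obtain ⟨c, hc, h⟩ := norm_complex_sin_cos_lower (δ := |β| * δ) (mul_pos (abs_pos.2 hβ) hδ)
  refine ⟨c, hc, fun z hz => ?_⟩
  have := h (β * z * Complex.I) fun k => ?_
  · rw [Complex.sin_mul_I, Complex.cos_mul_I, norm_mul, Complex.norm_I, mul_one] at this
    simpa [abs_mul] using this
  · have hβ' : (β : ℂ) ≠ 0 := by exact_mod_cast hβ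
    have e : β * z * Complex.I - k * (π / 2) =
        β * Complex.I * (z - (-k : ℤ) * (π / (2 * β) : ℝ) * Complex.I) := by
      push_cast
      field_simp
      linear_combination (-(k : ℂ) * π) * Complex.I_sq
    rw [e, norm_mul, norm_mul, Complex.norm_I, mul_one, Complex.norm_real, Real.norm_eq_abs]
    exact mul_le_mul_of_nonneg_left (hz _) (abs_nonneg _)

theorem norm_complex_sin_cos_pi_lower {δ : ℝ} (hδ : 0 < δ) :
    ∃ c > 0, ∀ z : ℂ, (∀ k : ℤ, δ ≤ ‖z - k / 2‖) →
      c * exp (π * |z.im|) ≤ ‖Complex.sin (π * z)‖ ∧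
      c * exp (π * |z.im|) ≤ ‖Complex.cos (π * z)‖ := by
  obtain ⟨c, hc, h⟩ := norm_complex_sin_cos_lower (δ := π * δ) (mul_pos pi_pos hδ)
  refine ⟨c, hc, fun z hz => ?_⟩
  have := h (π * z) fun k => ?_
  · simpa [abs_mul, abs_of_pos pi_pos] using this
  · have e : π * z - k * (π / 2) = π * (z - k / 2) := by ring
    rw [e, norm_mul, Complex.norm_real, Real.norm_eq_abs, abs_of_pos pi_pos]
    exact mul_le_mul_of_nonneg_left (hz _) pi_pos.le

theorem norm_complex_cosh_le (τ : ℝ) (z : ℂ) : ‖Complex.cosh (τ * z)‖ ≤ exp (|τ| * |z.re|) := by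
  have := norm_complex_cos_le (τ * z * Complex.I)
  rw [Complex.cos_mul_I] at this
  simpa [abs_mul] using this

theorem norm_complex_sinh_le (τ : ℝ) (z : ℂ) : ‖Complex.sinh (τ * z)‖ ≤ exp (|τ| * |z.re|) := by
  have := norm_complex_sin_le (τ * z * Complex.I)
  rw [Complex.sin_mul_I, norm_mul, Complex.norm_I, mul_one] at this
  simpa [abs_mul] using this

/-- Exponential decay away from the poles, for quotients whose denominator consists of three
hyperbolic factors and one trigonometric factor. -/
theorem quotient_decay {β τ : ℝ} (hβ : β ≠ 0) (hτ : |τ| < 3 * |β|) {δ : ℝ} (hδ : 0 < δ) :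
    ∃ C κ : ℝ, 0 < κ ∧ ∀ z, FarFromGrid (π / (2 * β)) δ z → ∀ N A B S : ℂ,
      ‖N‖ ≤ exp (|τ| * |z.re|) →
      (A = Complex.sinh (β * z) ∧ B = Complex.cosh (β * z) ∨
        A = Complex.cosh (β * z) ∧ B = Complex.sinh (β * z)) →
      (S = Complex.sin (π * z) ∨ S = Complex.cos (π * z)) →
      ‖N / (A * B ^ 2 * S)‖ ≤ C * exp (-κ * ‖z‖) := by
  obtain ⟨c₁, hc₁, h₁⟩ := norm_complex_sinh_cosh_lower hδ hβ
  obtain ⟨c₂, hc₂, h₂⟩ := norm_complex_sin_cos_pi_lower hδ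
  -- The quotient is at most a constant times `exp (-(3|β| - |τ|)|x| - π|y|)` for `z = x + iy`, and
  -- `‖z‖ ≤ |x| + |y|`.
  refine ⟨(c₁ ^ 3 * c₂)⁻¹, min (3 * |β| - |τ|) π, lt_min (by linarith) pi_pos, ?_⟩
  intro z hz N A B S hN hAB hS
  set κ := min (3 * |β| - |τ|) π with hκ
  obtain ⟨hs, hc⟩ := h₁ z hz.2
  obtain ⟨hs', hc'⟩ := h₂ z hz.1
  set E := exp (|β| * |z.re|) with hE
  set E' := exp (π * |z.im|) with hE'
  have hA : c₁ * E ≤ ‖A‖ := by rcases hAB with ⟨h, -⟩ | ⟨h, -⟩ <;> rw [h] <;> assumption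
  have hB : c₁ * E ≤ ‖B‖ := by rcases hAB with ⟨-, h⟩ | ⟨-, h⟩ <;> rw [h] <;> assumption
  have hS' : c₂ * E' ≤ ‖S‖ := by rcases hS with h | h <;> rw [h] <;> assumption
  have hEp : 0 < E := exp_pos _
  have hEp' : 0 < E' := exp_pos _
  rw [norm_div, norm_mul, norm_mul, norm_pow]
  have hden : c₁ * E * (c₁ * E) ^ 2 * (c₂ * E') ≤ ‖A‖ * ‖B‖ ^ 2 * ‖S‖ := by gcongr
  have hnum : exp (|τ| * |z.re|) ≤ exp (-κ * ‖z‖) * (E ^ 3 * E') := by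
    rw [hE, hE', ← exp_nat_mul, ← exp_add, ← exp_add]
    refine exp_le_exp.2 ?_
    have h1 := Complex.norm_le_abs_re_add_abs_im z
    have hk1 : κ ≤ 3 * |β| - |τ| := min_le_left _ _
    have hk2 : κ ≤ π := min_le_right _ _
    have hk0 : 0 < κ := lt_min (by linarith) pi_pos
    push_cast
    nlinarith [mul_le_mul_of_nonneg_left h1 hk0.le, mul_le_mul_of_nonneg_right hk1 (abs_nonneg z.re),
      mul_le_mul_of_nonneg_right hk2 (abs_nonneg z.im)]
  calc ‖N‖ / (‖A‖ * ‖B‖ ^ 2 * ‖S‖)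
      ≤ (exp (-κ * ‖z‖) * (E ^ 3 * E')) / (c₁ * E * (c₁ * E) ^ 2 * (c₂ * E')) :=
        div_le_div₀ (by positivity) (hN.trans hnum) (by positivity) hden
    _ = _ := by field_simp

/-! ### Local computation of residues at simple, double and triple poles -/

theorem tendsto_div_sub_of_hasDerivAt {v : ℂ → ℂ} {p v' : ℂ} (hv : HasDerivAt v v' p)
    (h0 : v p = 0) : Tendsto (fun z => v z / (z - p)) (𝓝[≠] p) (𝓝 v') := by
  have := hasDerivAt_iff_tendsto_slope.1 hv
  refine this.congr fun z => ?_
  rw [slope_def_field, h0, sub_zero]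

theorem hasResidue_simple {u v : ℂ → ℂ} {p v' : ℂ} (hu : ContinuousAt u p) (hv : HasDerivAt v v' p)
    (h0 : v p = 0) (hv' : v' ≠ 0) : HasResidue (fun z => u z / v z) p (u p / v') := by
  refine hasResidue_of_tendsto ?_
  have := (hu.tendsto.mono_left (nhdsWithin_le_nhds (s := {p}ᶜ))).div
    (tendsto_div_sub_of_hasDerivAt hv h0) hv'
  refine this.congr fun z => ?_
  simp only [Pi.div_apply, div_div_eq_mul_div]
  ring

/-- The hypothesis `hv` says that `v` has no quadratic term at its zero `p`. Hence `1 / v²` has no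
`1 / (z - p)` term, and the residue comes from the linear term of `u` alone. -/
theorem hasResidue_double {u v : ℂ → ℂ} {p u' v' : ℂ} (hu : HasDerivAt u u' p) (hv' : v' ≠ 0)
    (hv : Tendsto (fun z => (v z - v' * (z - p)) / (z - p) ^ 2) (𝓝[≠] p) (𝓝 0)) :
    HasResidue (fun z => u z / v z ^ 2) p (u' / v' ^ 2) := by
  refine ⟨u p / v' ^ 2, 0, ?_⟩
  have hh := tendsto_sub_self_nhdsNE p
  have hne : ∀ᶠ z in 𝓝[≠] p, z - p ≠ 0 := by
    filter_upwards [self_mem_nhdsWithin] with z hz using sub_ne_zero.2 hz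
  have hs : Tendsto (fun z => v z / (z - p)) (𝓝[≠] p) (𝓝 v') := by
    have := (hv.mul hh).add_const v'
    rw [zero_mul, zero_add] at this
    refine this.congr' ?_
    filter_upwards [hne] with z hz
    field_simp
    ring
  have hvne : ∀ᶠ z in 𝓝[≠] p, v z / (z - p) ≠ 0 := hs.eventually_ne hv'
  have hslope : Tendsto (fun z => (u z - u p) / (z - p)) (𝓝[≠] p) (𝓝 u') := by
    refine (hasDerivAt_iff_tendsto_slope.1 hu).congr fun z => ?_
    rw [slope_def_field]
  -- `h1` is the error of replacing `u` by its first-order Taylor polynomial, `h2` that of replacing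
  -- `v²` by `(v' (z - p))²`.
  have h1 := (hslope.sub_const u').div (hs.pow 2) (pow_ne_zero 2 hv')
  have h2 := ((((hh.const_mul u').const_add (u p)).mul hv).mul (hs.const_add v')).div
    ((hs.pow 2).mul_const (v' ^ 2)) (mul_ne_zero (pow_ne_zero 2 hv') (pow_ne_zero 2 hv'))
  have h3 := h1.sub h2
  simp only [sub_self, zero_div, mul_zero, zero_mul] at h3
  refine h3.congr' ?_
  filter_upwards [hne, hvne] with z hz hvz
  have hvz' : v z ≠ 0 := fun h => hvz (by rw [h, zero_div])
  simp only [Pi.div_apply]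
  field_simp
  ring

/-- Third order is needed because `sinh (l * h)` is divided by `h` before being expanded to second
order. -/
theorem exp_mul_expansion (l : ℂ) :
    (fun h => Complex.exp (l * h) - (1 + l * h + (l * h) ^ 2 / 2 + (l * h) ^ 3 / 6)) =o[𝓝[≠] 0]
      fun h => h ^ 3 := by
  have h1 := Complex.exp_sub_sum_range_succ_isLittleO_pow 3
  have h2 : Tendsto (fun h : ℂ => l * h) (𝓝[≠] 0) (𝓝 0) := by
    have : Tendsto (fun h : ℂ => l * h) (𝓝 0) (𝓝 (l * 0)) := (continuous_const_mul l).tendsto 0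
    rw [mul_zero] at this
    exact this.mono_left nhdsWithin_le_nhds
  have h3 := h1.comp_tendsto h2
  have h4 : ((fun x : ℂ => x ^ 3) ∘ fun h => l * h) =O[𝓝[≠] 0] fun h => h ^ 3 := by
    refine IsBigO.of_bound (‖l‖ ^ 3) (Eventually.of_forall fun h => ?_)
    simp [mul_pow]
  refine (h3.trans_isBigO h4).congr_left fun h => ?_
  simp [Finset.sum_range_succ, Nat.factorial]

theorem cosh_mul_expansion (l : ℂ) :
    Tendsto (fun h => (Complex.cosh (l * h) - 1) / h ^ 2) (𝓝[≠] 0) (𝓝 (l ^ 2 / 2)) := by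
  have h1 := ((exp_mul_expansion l).add (exp_mul_expansion (-l))).tendsto_div_nhds_zero
  have hh : Tendsto (fun h : ℂ => h) (𝓝[≠] 0) (𝓝 0) := nhdsWithin_le_nhds
  have h2 := ((h1.mul hh).div_const 2).add_const (l ^ 2 / 2)
  simp only [zero_mul, zero_div, zero_add] at h2
  refine h2.congr' ?_
  filter_upwards [self_mem_nhdsWithin] with h hne
  have hne' : h ≠ 0 := hne
  rw [Complex.cosh, neg_mul]
  field_simp
  ring

theorem sinh_mul_expansion (l : ℂ) :
    Tendsto (fun h => (Complex.sinh (l * h) / h - l) / h ^ 2) (𝓝[≠] 0) (𝓝 (l ^ 3 / 6)) := by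
  have h1 := ((exp_mul_expansion l).sub (exp_mul_expansion (-l))).tendsto_div_nhds_zero
  have h2 := (h1.div_const 2).add_const (l ^ 3 / 6)
  simp only [zero_div, zero_add] at h2
  refine h2.congr' ?_
  filter_upwards [self_mem_nhdsWithin] with h hne
  have hne' : h ≠ 0 := hne
  rw [Complex.sinh, neg_mul]
  field_simp
  ring

theorem sin_mul_expansion (l : ℂ) :
    Tendsto (fun h => (Complex.sin (l * h) / h - l) / h ^ 2) (𝓝[≠] 0) (𝓝 (-(l ^ 3 / 6))) := by
  have h1 := (sinh_mul_expansion (l * Complex.I)).div_const Complex.I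
  have hI := Complex.I_ne_zero
  have e : (l * Complex.I) ^ 3 / 6 / Complex.I = -(l ^ 3 / 6) := by
    field_simp
    rw [Complex.I_sq]
    ring
  rw [e] at h1
  refine h1.congr' ?_
  filter_upwards [self_mem_nhdsWithin] with h hne
  have hne' : h ≠ 0 := hne
  rw [mul_right_comm, Complex.sinh_mul_I]
  field_simp

/-- `f h = c₀ + c₂ h² + o(h²)` as `h → 0`. -/
def EvenExpansion (f : ℂ → ℂ) (c₀ c₂ : ℂ) : Prop :=
  Tendsto (fun h => (f h - c₀) / h ^ 2) (𝓝[≠] 0) (𝓝 c₂)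

theorem EvenExpansion.tendsto {f : ℂ → ℂ} {c₀ c₂ : ℂ} (hf : EvenExpansion f c₀ c₂) :
    Tendsto f (𝓝[≠] 0) (𝓝 c₀) := by
  have hh : Tendsto (fun h : ℂ => h) (𝓝[≠] 0) (𝓝 0) := nhdsWithin_le_nhds
  have h1 := (hf.mul (hh.pow 2)).add_const c₀
  simp only [ne_eq, OfNat.ofNat_ne_zero, not_false_eq_true, zero_pow, mul_zero, zero_add] at h1
  refine h1.congr' ?_
  filter_upwards [self_mem_nhdsWithin] with h hne
  have hne' : h ≠ 0 := hne
  field_simp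
  ring

theorem EvenExpansion.mul {f g : ℂ → ℂ} {c₀ c₂ d₀ d₂ : ℂ} (hf : EvenExpansion f c₀ c₂)
    (hg : EvenExpansion g d₀ d₂) :
    EvenExpansion (fun h => f h * g h) (c₀ * d₀) (c₂ * d₀ + c₀ * d₂) := by
  have h1 : Tendsto _ _ _ := hf
  have h2 : Tendsto _ _ _ := hg
  refine ((h1.mul hg.tendsto).add (h2.const_mul c₀)).congr fun h => ?_
  ring

theorem EvenExpansion.div {f g : ℂ → ℂ} {c₀ c₂ d₀ d₂ : ℂ} (hf : EvenExpansion f c₀ c₂)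
    (hg : EvenExpansion g d₀ d₂) (hd : d₀ ≠ 0) :
    EvenExpansion (fun h => f h / g h) (c₀ / d₀) ((c₂ * d₀ - c₀ * d₂) / d₀ ^ 2) := by
  have h1 : Tendsto _ _ _ := hf
  have h2 : Tendsto _ _ _ := hg
  have h3 := ((h1.mul_const d₀).sub (h2.const_mul c₀)).div (hg.tendsto.mul_const d₀)
    (mul_ne_zero hd hd)
  rw [← sq] at h3
  refine h3.congr' ?_
  filter_upwards [hg.tendsto.eventually_ne hd, self_mem_nhdsWithin] with h hgh hne
  have hne' : h ≠ 0 := hne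
  simp only [Pi.div_apply]
  field_simp
  ring

/-- Needed only for `cgFun` at the origin, where `sinh² βz sin πz` vanishes to order three. -/
theorem hasResidue_triple {F f : ℂ → ℂ} {c₀ c₂ : ℂ} (hf : EvenExpansion f c₀ c₂)
    (hF : ∀ᶠ h in 𝓝[≠] (0 : ℂ), F h = f h / h ^ 3) : HasResidue F 0 c₂ := by
  refine ⟨0, c₀, ?_⟩
  have h1 : Tendsto _ _ _ := hf.sub_const c₂
  rw [sub_self] at h1
  refine h1.congr' ?_
  filter_upwards [hF, self_mem_nhdsWithin] with h hFh hne
  have hne' : h ≠ 0 := hne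
  rw [hFh, sub_zero]
  field_simp
  ring

/-- By the addition formula the function equals `cosh (βp) sinh (β(z - p))`, which is odd about `p`,
so its quadratic term vanishes. This is the hypothesis required by `hasResidue_double`. -/
theorem sinh_linear_at_zero {β p : ℂ} (hp : Complex.sinh (β * p) = 0) :
    Tendsto (fun z => (Complex.sinh (β * z) - Complex.cosh (β * p) * β * (z - p)) / (z - p) ^ 2)
      (𝓝[≠] p) (𝓝 0) := by
  have hsub : Tendsto (fun z : ℂ => z - p) (𝓝[≠] p) (𝓝[≠] 0) :=
    tendsto_nhdsWithin_iff.2 ⟨tendsto_sub_self_nhdsNE p, by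
      filter_upwards [self_mem_nhdsWithin] with z hz using sub_ne_zero.2 hz⟩
  have h1 := (((sinh_mul_expansion β).comp hsub).mul (tendsto_sub_self_nhdsNE p)).const_mul
    (Complex.cosh (β * p))
  rw [mul_zero, mul_zero] at h1
  refine h1.congr' ?_
  filter_upwards [self_mem_nhdsWithin] with z hz
  have hz' : z - p ≠ 0 := sub_ne_zero.2 hz
  have e : Complex.sinh (β * z) = Complex.cosh (β * p) * Complex.sinh (β * (z - p)) := by
    have : β * z = β * p + β * (z - p) := by ring
    rw [this, Complex.sinh_add, hp]
    ring
  simp only [Function.comp_apply]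
  rw [e]
  field_simp

theorem cosh_linear_at_zero {β p : ℂ} (hp : Complex.cosh (β * p) = 0) :
    Tendsto (fun z => (Complex.cosh (β * z) - Complex.sinh (β * p) * β * (z - p)) / (z - p) ^ 2)
      (𝓝[≠] p) (𝓝 0) := by
  have hsub : Tendsto (fun z : ℂ => z - p) (𝓝[≠] p) (𝓝[≠] 0) :=
    tendsto_nhdsWithin_iff.2 ⟨tendsto_sub_self_nhdsNE p, by
      filter_upwards [self_mem_nhdsWithin] with z hz using sub_ne_zero.2 hz⟩
  have h1 := (((sinh_mul_expansion β).comp hsub).mul (tendsto_sub_self_nhdsNE p)).const_mul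
    (Complex.sinh (β * p))
  rw [mul_zero, mul_zero] at h1
  refine h1.congr' ?_
  filter_upwards [self_mem_nhdsWithin] with z hz
  have hz' : z - p ≠ 0 := sub_ne_zero.2 hz
  have e : Complex.cosh (β * z) = Complex.sinh (β * p) * Complex.sinh (β * (z - p)) := by
    have : β * z = β * p + β * (z - p) := by ring
    rw [this, Complex.cosh_add, hp]
    ring
  simp only [Function.comp_apply]
  rw [e]
  field_simp

theorem hasResidue_zero_trig {N A B S : ℂ → ℂ} {p S' : ℂ} (hN : ContinuousAt N p)
    (hA : ContinuousAt A p) (hB : ContinuousAt B p) (hS : HasDerivAt S S' p) (hA0 : A p ≠ 0)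
    (hB0 : B p ≠ 0) (hS0 : S p = 0) (hS' : S' ≠ 0) :
    HasResidue (fun z => N z / (A z * B z ^ 2 * S z)) p (N p / (A p * B p ^ 2 * S')) := by
  have h := hasResidue_simple (hN.div (hA.mul (hB.pow 2)) (mul_ne_zero hA0 (pow_ne_zero 2 hB0)))
    hS hS0 hS'
  simpa only [Pi.div_apply, Pi.mul_apply, Pi.pow_apply, div_div] using h

theorem hasResidue_zero_simple {N A B S : ℂ → ℂ} {p A' : ℂ} (hN : ContinuousAt N p)
    (hA : HasDerivAt A A' p) (hB : ContinuousAt B p) (hS : ContinuousAt S p) (hA0 : A p = 0)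
    (hB0 : B p ≠ 0) (hS0 : S p ≠ 0) (hA' : A' ≠ 0) :
    HasResidue (fun z => N z / (A z * B z ^ 2 * S z)) p (N p / (A' * B p ^ 2 * S p)) := by
  have h := hasResidue_simple (hN.div ((hB.pow 2).mul hS) (mul_ne_zero (pow_ne_zero 2 hB0) hS0))
    hA hA0 hA'
  convert h using 1
  · funext z
    simp only [Pi.div_apply, Pi.mul_apply, Pi.pow_apply, div_div]
    ring
  · simp only [Pi.div_apply, Pi.mul_apply, Pi.pow_apply, div_div]
    ring

/-- The derivative of `A` is 0 because `A` is proportional to the derivative of `B`, and `A'` to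
`B`, which vanishes at `p`. Hence only `N'` and `S'` appear in the residue. -/
theorem hasResidue_zero_double {N A B S : ℂ → ℂ} {p N' S' B' : ℂ} (hN : HasDerivAt N N' p)
    (hA : HasDerivAt A 0 p) (hS : HasDerivAt S S' p)
    (hB : Tendsto (fun z => (B z - B' * (z - p)) / (z - p) ^ 2) (𝓝[≠] p) (𝓝 0))
    (hA0 : A p ≠ 0) (hS0 : S p ≠ 0) (hB' : B' ≠ 0) :
    HasResidue (fun z => N z / (A z * B z ^ 2 * S z)) p
      ((N' * S p - N p * S') / (A p * S p ^ 2 * B' ^ 2)) := by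
  have h := hasResidue_double (hN.div (hA.mul hS) (mul_ne_zero hA0 hS0)) hB' hB
  convert h using 1
  · funext z
    simp only [Pi.div_apply, Pi.mul_apply, div_div]
    ring
  · simp only [Pi.mul_apply]
    field_simp
    ring

/-! ### The residue sum for the quotients `N / (A B² S)` -/

theorem sinh_eq_zero_grid {β : ℝ} (hβ : β ≠ 0) {z : ℂ} (h : Complex.sinh (β * z) = 0) :
    ∃ k : ℤ, z = k * (π / (2 * β) : ℝ) * Complex.I := by
  have h1 : Complex.sin (β * z * Complex.I) = 0 := by rw [Complex.sin_mul_I, h, zero_mul]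
  obtain ⟨k, hk⟩ := Complex.sin_eq_zero_iff.1 h1
  -- Zeros of `sinh` are the even nodes of the grid of step `π / (2β)`, and those of `cosh` the odd
  -- ones; the sign comes from the rotation by `I`.
  refine ⟨-2 * k, ?_⟩
  have hβ' : (β : ℂ) ≠ 0 := by exact_mod_cast hβ
  push_cast
  field_simp
  linear_combination (-Complex.I) * hk + β * z * Complex.I_sq

theorem cosh_eq_zero_grid {β : ℝ} (hβ : β ≠ 0) {z : ℂ} (h : Complex.cosh (β * z) = 0) :
    ∃ k : ℤ, z = k * (π / (2 * β) : ℝ) * Complex.I := by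
  have h1 : Complex.cos (β * z * Complex.I) = 0 := by rw [Complex.cos_mul_I, h]
  obtain ⟨k, hk⟩ := Complex.cos_eq_zero_iff.1 h1
  refine ⟨-(2 * k + 1), ?_⟩
  have hβ' : (β : ℂ) ≠ 0 := by exact_mod_cast hβ
  push_cast
  field_simp
  linear_combination (-2 * Complex.I) * hk + 2 * β * z * Complex.I_sq

/-- The residue sum for an odd quotient `N / (A B² S)`. -/
theorem quotient_residue_sum {β τ : ℝ} (hβ : β ≠ 0) (hτ : |τ| < 3 * |β|) {N A B S : ℂ → ℂ} {m : ℕ}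
    (hN : N = (fun z => Complex.sinh (τ * z)) ∨ N = fun z => Complex.cosh (τ * z))
    (hAB : (A = (fun z => Complex.sinh (β * z)) ∧ B = fun z => Complex.cosh (β * z)) ∨
      (A = (fun z => Complex.cosh (β * z)) ∧ B = fun z => Complex.sinh (β * z)))
    (hS : (S = (fun z => Complex.sin (π * z)) ∧ m = 2) ∨
      (S = (fun z => Complex.cos (π * z)) ∧ m = 1))
    (hodd : ∀ z, N (-z) / (A (-z) * B (-z) ^ 2 * S (-z)) = -(N z / (A z * B z ^ 2 * S z)))
    {r₀ : ℂ} {rx re ro : ℕ → ℂ}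
    (h0 : HasResidue (fun z => N z / (A z * B z ^ 2 * S z)) 0 r₀)
    (hx : ∀ n : ℕ, HasResidue (fun z => N z / (A z * B z ^ 2 * S z)) (n + m / 2) (rx n))
    (he : ∀ j : ℕ, HasResidue (fun z => N z / (A z * B z ^ 2 * S z))
      (((2 * j + 1) * (π / (2 * β)) : ℝ) * Complex.I) (re j))
    (ho : ∀ j : ℕ, HasResidue (fun z => N z / (A z * B z ^ 2 * S z))
      (((2 * j + 2) * (π / (2 * β)) : ℝ) * Complex.I) (ro j))
    {X E O : ℂ} (hX : HasSum rx X) (hE : HasSum re E) (hO : HasSum ro O) :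
    r₀ + 2 * (X + (E + O)) = 0 := by
  have hd : π / (2 * β) ≠ 0 := div_ne_zero pi_ne_zero (mul_ne_zero two_ne_zero hβ)
  have hm : 0 < m := by rcases hS with ⟨-, rfl⟩ | ⟨-, rfl⟩ <;> norm_num
  -- The `k`-th pole has ordinate `(k + 1)π / (2β)`, so even `k` gives the odd nodes (zeros of
  -- `cosh`) and odd `k` the even nodes (zeros of `sinh`).
  set ry : ℕ → ℂ := fun k => if Even k then re (k / 2) else ro (k / 2) with hry
  have hre : ∀ j, ry (2 * j) = re j := fun j => by simp [hry]
  have hro : ∀ j, ry (2 * j + 1) = ro j := fun j => by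
    have : (2 * j + 1) / 2 = j := by omega
    simp [hry, this]
  have hY : HasSum ry (E + O) := by
    refine HasSum.even_add_odd ?_ ?_
    · simpa only [hre] using hE
    · simpa only [hro] using hO
  refine odd_residue_sum (d := π / (2 * β)) (rx := rx) (ry := ry) hd hm hodd h0 hx (fun k => ?_)
    (fun z hz0 hzx hzy => ?_) (fun δ hδ => ?_) hX hY
  · rcases Nat.even_or_odd' k with ⟨j, rfl | rfl⟩
    · rw [hre]
      convert he j using 1
      push_cast
      ring
    · rw [hro]
      convert ho j using 1
      push_cast
      ring
  · have hgrid : ∀ k : ℤ, z ≠ k * (π / (2 * β) : ℝ) * Complex.I := by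
      rintro ((_ | n) | n) h
      · exact hz0 (by simpa using h)
      · exact (hzy n).1 (by rw [h, Int.ofNat_eq_natCast]; push_cast; ring)
      · exact (hzy n).2 (by rw [h, Int.cast_negSucc]; push_cast; ring)
    have hs0 : Complex.sinh (β * z) ≠ 0 := fun h =>
      let ⟨k, hk⟩ := sinh_eq_zero_grid hβ h
      hgrid k hk
    have hc0 : Complex.cosh (β * z) ≠ 0 := fun h =>
      let ⟨k, hk⟩ := cosh_eq_zero_grid hβ h
      hgrid k hk
    have hpi : (π : ℂ) ≠ 0 := by exact_mod_cast pi_ne_zero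
    -- The offset `m / 2` encodes the zeros of `S`: nonzero zeros `±(n + 1)` of `sin πz` for `m =
    -- 2`, and `±(n + 1/2)` of `cos πz` for `m = 1`.
    have hS0 : S z ≠ 0 := by
      rcases hS with ⟨rfl, rfl⟩ | ⟨rfl, rfl⟩
      · intro h
        obtain ⟨k, hk⟩ := Complex.sin_eq_zero_iff.1 h
        have hk' : z = k := mul_left_cancel₀ hpi (by rw [hk]; ring)
        rcases k with (_ | n) | n
        · exact hz0 (by simpa using hk')
        · exact (hzx n).1 (by rw [hk', Int.ofNat_eq_natCast]; push_cast; ring)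
        · exact (hzx n).2 (by rw [hk', Int.cast_negSucc]; push_cast; ring)
      · intro h
        obtain ⟨k, hk⟩ := Complex.cos_eq_zero_iff.1 h
        have hk' : z = k + 1 / 2 := mul_left_cancel₀ hpi (by rw [hk]; ring)
        rcases k with n | n
        · exact (hzx n).1 (by rw [hk', Int.ofNat_eq_natCast]; push_cast; ring)
        · exact (hzx n).2 (by rw [hk', Int.cast_negSucc]; push_cast; ring)
    have hND : DifferentiableAt ℂ N z := by rcases hN with rfl | rfl <;> fun_prop
    have hSD : DifferentiableAt ℂ S z := by rcases hS with ⟨rfl, -⟩ | ⟨rfl, -⟩ <;> fun_prop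
    rcases hAB with ⟨rfl, rfl⟩ | ⟨rfl, rfl⟩
    · exact hND.div (by fun_prop) (mul_ne_zero (mul_ne_zero hs0 (pow_ne_zero 2 hc0)) hS0)
    · exact hND.div (by fun_prop) (mul_ne_zero (mul_ne_zero hc0 (pow_ne_zero 2 hs0)) hS0)
  · obtain ⟨C, κ, hκ, h⟩ := quotient_decay hβ hτ hδ
    refine ⟨C, κ, hκ, fun z hz => h z hz _ _ _ _ ?_ ?_ ?_⟩
    · rcases hN with rfl | rfl
      exacts [norm_complex_sinh_le τ z, norm_complex_cosh_le τ z]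
    · rcases hAB with ⟨rfl, rfl⟩ | ⟨rfl, rfl⟩
      exacts [Or.inl ⟨rfl, rfl⟩, Or.inr ⟨rfl, rfl⟩]
    · rcases hS with ⟨rfl, -⟩ | ⟨rfl, -⟩
      exacts [Or.inl rfl, Or.inr rfl]

/-! ### Convergence of the real series -/

theorem summable_div_of_exp_bounds {N D : ℕ → ℝ} {s p q c : ℝ} (hc : 0 < c) (hpq : p < q)
    (hN : ∀ n : ℕ, |N n| ≤ exp (p * (n + s))) (hD : ∀ n : ℕ, c * exp (q * (n + s)) ≤ |D n|) :
    Summable fun n => N n / D n := by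
  have hs : Summable fun n : ℕ => c⁻¹ * exp ((p - q) * s) * exp (n * (p - q)) :=
    (Real.summable_exp_nat_mul_iff.2 (by linarith)).mul_left _
  refine Summable.of_norm_bounded hs fun n => ?_
  rw [Real.norm_eq_abs, abs_div]
  calc |N n| / |D n| ≤ exp (p * (n + s)) / (c * exp (q * (n + s))) :=
        div_le_div₀ (exp_pos _).le (hN n) (by positivity) (hD n)
    _ = c⁻¹ * (exp (p * (n + s)) / exp (q * (n + s))) := by field_simp
    _ = _ := by
        rw [← exp_sub, mul_assoc, ← exp_add]
        ring_nf

/-- All arguments satisfy `|r (n + s)| ≥ |r| s > 0`, so one constant bounds `sinh` below for every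
`n`; the same constant serves for `cosh`. -/
theorem sinh_cosh_lower {r s : ℝ} (hr : r ≠ 0) (hs : 0 < s) :
    ∃ c > 0, ∀ n : ℕ, c * exp (|r| * (n + s)) ≤ |sinh (r * (n + s))| ∧
      c * exp (|r| * (n + s)) ≤ |cosh (r * (n + s))| := by
  have hrs : 0 < |r| * s := mul_pos (abs_pos.2 hr) hs
  have hE : exp (-(2 * (|r| * s))) < 1 := by rw [exp_lt_one_iff]; linarith
  refine ⟨(1 - exp (-(2 * (|r| * s)))) / 2, by linarith, fun n => ?_⟩
  have e : |r * (n + s)| = |r| * (n + s) := by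
    rw [abs_mul, abs_of_pos (by positivity : (0 : ℝ) < n + s)]
  have hle : |r| * s ≤ |r * (n + s)| := by
    rw [e]
    exact mul_le_mul_of_nonneg_left (by simp) (abs_nonneg _)
  have h1 := exp_abs_mul_le_abs_sinh hle
  have h2 := exp_abs_le_two_mul_cosh (r * (n + s))
  rw [e] at h1 h2
  refine ⟨h1, ?_⟩
  rw [abs_of_pos (cosh_pos _)]
  nlinarith [exp_pos (|r| * (n + s)), exp_pos (-(2 * (|r| * s)))]

theorem abs_neg_one_pow_mul (k : ℕ) (x : ℝ) : |(-1) ^ k * x| = |x| := by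
  rw [abs_mul, abs_pow, abs_neg, abs_one, one_pow, one_mul]

theorem abs_cosh_mul_le {s : ℝ} (hs : 0 < s) (r : ℝ) (n : ℕ) :
    |cosh (r * (n + s))| ≤ exp (|r| * (n + s)) := by
  have e : |r * (n + s)| = |r| * (n + s) := by
    rw [abs_mul, abs_of_pos (by positivity : (0 : ℝ) < n + s)]
  rw [abs_of_pos (cosh_pos _), ← cosh_abs, e, cosh_eq]
  have : exp (-(|r| * (n + s))) ≤ exp (|r| * (n + s)) :=
    exp_le_exp.2 (neg_le_self (by positivity))
  linarith

theorem abs_sinh_mul_le {s : ℝ} (hs : 0 < s) (r : ℝ) (n : ℕ) :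
    |sinh (r * (n + s))| ≤ exp (|r| * (n + s)) := by
  refine le_trans ?_ (abs_cosh_mul_le hs r n)
  rw [← sq_le_sq]
  linarith [cosh_sq (r * (n + s))]

/-! Summability of the three types of series. -/

theorem summable_bounded_div {t D : ℕ → ℝ} {s α : ℝ} (hs : 0 < s) (hα : α ≠ 0)
    (ht : ∀ n, |t n| ≤ 1)
    (hD : D = (fun n : ℕ => sinh (α * (n + s))) ∨ D = fun n : ℕ => cosh (α * (n + s))) :
    Summable fun n => t n / D n := by
  obtain ⟨c, hc, h⟩ := sinh_cosh_lower hα hs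
  refine summable_div_of_exp_bounds (s := s) (p := 0) (q := |α|) hc (abs_pos.2 hα)
    (fun n => by simpa using ht n) (fun n => ?_)
  rcases hD with rfl | rfl
  exacts [(h n).1, (h n).2]

theorem summable_bounded_mul_div_sq {t M D : ℕ → ℝ} {s α : ℝ} (hs : 0 < s) (hα : α ≠ 0)
    (ht : ∀ n, |t n| ≤ 1)
    (hMD : (M = (fun n : ℕ => cosh (α * (n + s))) ∧ D = fun n : ℕ => sinh (α * (n + s))) ∨
      (M = (fun n : ℕ => sinh (α * (n + s))) ∧ D = fun n : ℕ => cosh (α * (n + s)))) :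
    Summable fun n => t n * M n / D n ^ 2 := by
  obtain ⟨c, hc, h⟩ := sinh_cosh_lower hα hs
  have hM : ∀ n : ℕ, |M n| ≤ exp (|α| * (n + s)) := fun n => by
    rcases hMD with ⟨rfl, -⟩ | ⟨rfl, -⟩
    exacts [abs_cosh_mul_le hs α n, abs_sinh_mul_le hs α n]
  have hD : ∀ n : ℕ, c * exp (|α| * (n + s)) ≤ |D n| := fun n => by
    rcases hMD with ⟨-, rfl⟩ | ⟨-, rfl⟩
    exacts [(h n).1, (h n).2]
  refine summable_div_of_exp_bounds (s := s) (p := |α|) (q := 2 * |α|) (pow_pos hc 2)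
    (by linarith [abs_pos.2 hα]) (fun n => ?_) (fun n => ?_)
  · rw [abs_mul]
    exact (mul_le_of_le_one_left (abs_nonneg _) (ht n)).trans (hM n)
  · have e : c ^ 2 * exp (2 * |α| * (n + s)) = (c * exp (|α| * (n + s))) ^ 2 := by
      rw [mul_pow, ← exp_nat_mul]
      push_cast
      ring_nf
    rw [e, abs_pow]
    exact pow_le_pow_left₀ (by positivity) (hD n) 2

theorem summable_hyp_div {N A B : ℕ → ℝ} {s τ β : ℝ} (hs : 0 < s) (hβ : β ≠ 0)
    (hτ : |τ| < 3 * |β|)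
    (hN : ∀ n, |N n| ≤ exp (|τ| * (n + s)))
    (hAB : (A = (fun n : ℕ => sinh (β * (n + s))) ∧ B = fun n : ℕ => cosh (β * (n + s))) ∨
      (A = (fun n : ℕ => cosh (β * (n + s))) ∧ B = fun n : ℕ => sinh (β * (n + s)))) :
    Summable fun n => N n / (A n * B n ^ 2) := by
  obtain ⟨c, hc, h⟩ := sinh_cosh_lower hβ hs
  have hA : ∀ n : ℕ, c * exp (|β| * (n + s)) ≤ |A n| := fun n => by
    rcases hAB with ⟨rfl, -⟩ | ⟨rfl, -⟩
    exacts [(h n).1, (h n).2]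
  have hB : ∀ n : ℕ, c * exp (|β| * (n + s)) ≤ |B n| := fun n => by
    rcases hAB with ⟨-, rfl⟩ | ⟨-, rfl⟩
    exacts [(h n).2, (h n).1]
  refine summable_div_of_exp_bounds (s := s) (p := |τ|) (q := 3 * |β|) (pow_pos hc 3) hτ hN
    (fun n => ?_)
  have e : c ^ 3 * exp (3 * |β| * (n + s)) =
      c * exp (|β| * (n + s)) * (c * exp (|β| * (n + s))) ^ 2 := by
    rw [mul_assoc 3, show (3 : ℝ) = ((3 : ℕ) : ℝ) by norm_num, exp_nat_mul]
    ring
  rw [e, abs_mul, abs_pow]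
  have := hA n
  have := hB n
  gcongr

/-! The terms of the series in terms of the ratios of the parameters. -/

theorem ceHyp_succ (a b θ : ℝ) (n : ℕ) : ceHyp a b θ (n + 1) = (-1) ^ (n + 1) *
    sinh (θ / a * (n + 1)) / (sinh (b * π / a * (n + 1)) * cosh (b * π / a * (n + 1)) ^ 2) := by
  unfold ceHyp; push_cast; ring_nf

theorem sinOverSinh_succ (a b θ : ℝ) (n : ℕ) : sinOverSinh a b θ (n + 1) = (-1) ^ (n + 1) *
    sin (θ / b * (n + 1)) / sinh (a * π / b * (n + 1)) := by
  unfold sinOverSinh; push_cast; ring_nf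

theorem two_mul_succ_sub_one (x : ℝ) (c : ℝ) (n : ℕ) :
    (2 * ((n + 1 : ℕ) : ℝ) - 1) * x / (2 * c) = x / c * (n + 1 / 2) := by
  push_cast; ring

theorem two_mul_succ_sub_one_mul (x y : ℝ) (c : ℝ) (n : ℕ) :
    (2 * ((n + 1 : ℕ) : ℝ) - 1) * x * y / (2 * c) = x * y / c * (n + 1 / 2) := by
  push_cast; ring

theorem ceCosOdd_succ (a b θ : ℝ) (n : ℕ) : ceCosOdd a b θ (n + 1) = (-1) ^ (n + 1) *
    cos (θ / b * (n + 1 / 2)) / sinh (a * π / b * (n + 1 / 2)) := by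
  unfold ceCosOdd; rw [two_mul_succ_sub_one, two_mul_succ_sub_one_mul]

theorem ceSinOdd_succ (a b θ : ℝ) (n : ℕ) : ceSinOdd a b θ (n + 1) = (-1) ^ (n + 1) *
    sin (θ / b * (n + 1 / 2)) * cosh (a * π / b * (n + 1 / 2)) /
      sinh (a * π / b * (n + 1 / 2)) ^ 2 := by
  unfold ceSinOdd; rw [two_mul_succ_sub_one, two_mul_succ_sub_one_mul]

theorem cfHyp_succ (a b θ : ℝ) (n : ℕ) : cfHyp a b θ (n + 1) = (-1) ^ (n + 1) *
    cosh (θ / a * (n + 1 / 2)) /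
      (sinh (b * π / a * (n + 1 / 2)) * cosh (b * π / a * (n + 1 / 2)) ^ 2) := by
  unfold cfHyp; rw [two_mul_succ_sub_one, two_mul_succ_sub_one_mul]

theorem cfSinOdd_succ (a b θ : ℝ) (n : ℕ) : cfSinOdd a b θ (n + 1) = (-1) ^ (n + 1) *
    sin (θ / b * (n + 1 / 2)) / cosh (a * π / b * (n + 1 / 2)) := by
  unfold cfSinOdd; rw [two_mul_succ_sub_one, two_mul_succ_sub_one_mul]

theorem cfCosOdd_succ (a b θ : ℝ) (n : ℕ) : cfCosOdd a b θ (n + 1) = (-1) ^ (n + 1) *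
    cos (θ / b * (n + 1 / 2)) * sinh (a * π / b * (n + 1 / 2)) /
      cosh (a * π / b * (n + 1 / 2)) ^ 2 := by
  unfold cfCosOdd; rw [two_mul_succ_sub_one, two_mul_succ_sub_one_mul]

theorem cfCos_succ (a b θ : ℝ) (n : ℕ) : cfCos a b θ (n + 1) = (-1) ^ (n + 1) *
    cos (θ / b * (n + 1)) / cosh (a * π / b * (n + 1)) := by
  unfold cfCos; push_cast; ring_nf

/-- The factors are reordered so that the denominator has the form `A * B ^ 2` with `B` the
hyperbolic sine. -/
theorem cgHyp_succ (a b θ : ℝ) (n : ℕ) : cgHyp a b θ (n + 1) = (-1) ^ (n + 1) *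
    cosh (θ / a * (n + 1)) / (cosh (b * π / a * (n + 1)) * sinh (b * π / a * (n + 1)) ^ 2) := by
  unfold cgHyp; push_cast; ring_nf

theorem cgCos_succ (a b θ : ℝ) (n : ℕ) : cgCos a b θ (n + 1) = (-1) ^ (n + 1) *
    cos (θ / b * (n + 1)) * cosh (a * π / b * (n + 1)) / sinh (a * π / b * (n + 1)) ^ 2 := by
  unfold cgCos; push_cast; ring_nf

theorem cgCosOdd_succ (a b θ : ℝ) (n : ℕ) : cgCosOdd a b θ (n + 1) = (-1) ^ n *
    cos (θ / b * (n + 1 / 2)) / sinh (a * π / b * (n + 1 / 2)) := by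
  unfold cgCosOdd; rw [two_mul_succ_sub_one, two_mul_succ_sub_one_mul, Nat.add_sub_cancel]

section Convergence

variable {a b θ : ℝ}

/-- This is the condition `|τ| < 3|β|`; no sign of `b` is needed since `b * π ≤ |b * π|`. -/
theorem abs_div_lt_of_abs_lt (ha : a ≠ 0) (hθ : |θ| < 3 * b * π) :
    |θ / a| < 3 * |b * π / a| := by
  have h := le_abs_self (b * π)
  rw [abs_div, abs_div, ← mul_div_assoc]
  exact div_lt_div_of_pos_right (by linarith) (abs_pos.2 ha)

theorem convFromOne_ceHyp (ha : a ≠ 0) (hb : b ≠ 0) (hθ : |θ| < 3 * b * π) :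
    ConvFromOne (ceHyp a b θ) := by
  simp only [ConvFromOne, ceHyp_succ]
  refine summable_hyp_div one_pos (by positivity) (abs_div_lt_of_abs_lt ha hθ) (fun n => ?_)
    (Or.inl ⟨rfl, rfl⟩)
  rw [abs_neg_one_pow_mul]
  exact abs_sinh_mul_le one_pos _ n

theorem convFromOne_cfHyp (ha : a ≠ 0) (hb : b ≠ 0) (hθ : |θ| < 3 * b * π) :
    ConvFromOne (cfHyp a b θ) := by
  simp only [ConvFromOne, cfHyp_succ]
  refine summable_hyp_div one_half_pos (by positivity) (abs_div_lt_of_abs_lt ha hθ) (fun n => ?_)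
    (Or.inl ⟨rfl, rfl⟩)
  rw [abs_neg_one_pow_mul]
  exact abs_cosh_mul_le one_half_pos _ n

theorem convFromOne_cgHyp (ha : a ≠ 0) (hb : b ≠ 0) (hθ : |θ| < 3 * b * π) :
    ConvFromOne (cgHyp a b θ) := by
  simp only [ConvFromOne, cgHyp_succ]
  refine summable_hyp_div one_pos (by positivity) (abs_div_lt_of_abs_lt ha hθ) (fun n => ?_)
    (Or.inr ⟨rfl, rfl⟩)
  rw [abs_neg_one_pow_mul]
  exact abs_cosh_mul_le one_pos _ n

theorem convFromOne_sinOverSinh (ha : a ≠ 0) (hb : b ≠ 0) : ConvFromOne (sinOverSinh a b θ) := by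
  simp only [ConvFromOne, sinOverSinh_succ]
  refine summable_bounded_div one_pos (by positivity) (fun n => ?_) (Or.inl rfl)
  rw [abs_neg_one_pow_mul]
  exact abs_sin_le_one _

theorem convFromOne_ceCosOdd (ha : a ≠ 0) (hb : b ≠ 0) : ConvFromOne (ceCosOdd a b θ) := by
  simp only [ConvFromOne, ceCosOdd_succ]
  refine summable_bounded_div one_half_pos (by positivity) (fun n => ?_) (Or.inl rfl)
  rw [abs_neg_one_pow_mul]
  exact abs_cos_le_one _

theorem convFromOne_cfSinOdd (ha : a ≠ 0) (hb : b ≠ 0) : ConvFromOne (cfSinOdd a b θ) := by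
  simp only [ConvFromOne, cfSinOdd_succ]
  refine summable_bounded_div one_half_pos (by positivity) (fun n => ?_) (Or.inr rfl)
  rw [abs_neg_one_pow_mul]
  exact abs_sin_le_one _

theorem convFromOne_cfCos (ha : a ≠ 0) (hb : b ≠ 0) : ConvFromOne (cfCos a b θ) := by
  simp only [ConvFromOne, cfCos_succ]
  refine summable_bounded_div one_pos (by positivity) (fun n => ?_) (Or.inr rfl)
  rw [abs_neg_one_pow_mul]
  exact abs_cos_le_one _

theorem convFromOne_cgCosOdd (ha : a ≠ 0) (hb : b ≠ 0) : ConvFromOne (cgCosOdd a b θ) := by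
  simp only [ConvFromOne, cgCosOdd_succ]
  refine summable_bounded_div one_half_pos (by positivity) (fun n => ?_) (Or.inl rfl)
  rw [abs_neg_one_pow_mul]
  exact abs_cos_le_one _

theorem convFromOne_ceSinOdd (ha : a ≠ 0) (hb : b ≠ 0) : ConvFromOne (ceSinOdd a b θ) := by
  simp only [ConvFromOne, ceSinOdd_succ]
  refine summable_bounded_mul_div_sq one_half_pos (by positivity) (fun n => ?_) (Or.inl ⟨rfl, rfl⟩)
  rw [abs_neg_one_pow_mul]
  exact abs_sin_le_one _

theorem convFromOne_cfCosOdd (ha : a ≠ 0) (hb : b ≠ 0) : ConvFromOne (cfCosOdd a b θ) := by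
  simp only [ConvFromOne, cfCosOdd_succ]
  refine summable_bounded_mul_div_sq one_half_pos (by positivity) (fun n => ?_) (Or.inr ⟨rfl, rfl⟩)
  rw [abs_neg_one_pow_mul]
  exact abs_cos_le_one _

theorem convFromOne_cgCos (ha : a ≠ 0) (hb : b ≠ 0) : ConvFromOne (cgCos a b θ) := by
  simp only [ConvFromOne, cgCos_succ]
  refine summable_bounded_mul_div_sq one_pos (by positivity) (fun n => ?_) (Or.inl ⟨rfl, rfl⟩)
  rw [abs_neg_one_pow_mul]
  exact abs_cos_le_one _

end Convergence

/-! ### Derivatives, and values on the imaginary axis -/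

theorem hasDerivAt_sinh_mul (l p : ℂ) :
    HasDerivAt (fun z => Complex.sinh (l * z)) (Complex.cosh (l * p) * l) p := by
  simpa using ((hasDerivAt_id p).const_mul l).csinh

theorem hasDerivAt_cosh_mul (l p : ℂ) :
    HasDerivAt (fun z => Complex.cosh (l * z)) (Complex.sinh (l * p) * l) p := by
  simpa using ((hasDerivAt_id p).const_mul l).ccosh

theorem hasDerivAt_sin_mul (l p : ℂ) :
    HasDerivAt (fun z => Complex.sin (l * z)) (Complex.cos (l * p) * l) p := by
  simpa using ((hasDerivAt_id p).const_mul l).csin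

theorem hasDerivAt_cos_mul (l p : ℂ) :
    HasDerivAt (fun z => Complex.cos (l * z)) (-Complex.sin (l * p) * l) p := by
  simpa using ((hasDerivAt_id p).const_mul l).ccos

theorem sinh_mul_mul_I (l y : ℝ) :
    Complex.sinh (l * (y * Complex.I)) = (sin (l * y) : ℝ) * Complex.I := by
  rw [← mul_assoc, Complex.sinh_mul_I]; push_cast; rfl

theorem cosh_mul_mul_I (l y : ℝ) : Complex.cosh (l * (y * Complex.I)) = (cos (l * y) : ℝ) := by
  rw [← mul_assoc, Complex.cosh_mul_I]; push_cast; rfl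

theorem sin_mul_mul_I (l y : ℝ) :
    Complex.sin (l * (y * Complex.I)) = (sinh (l * y) : ℝ) * Complex.I := by
  rw [← mul_assoc, Complex.sin_mul_I]; push_cast; rfl

theorem cos_mul_mul_I (l y : ℝ) : Complex.cos (l * (y * Complex.I)) = (cosh (l * y) : ℝ) := by
  rw [← mul_assoc, Complex.cos_mul_I]; push_cast; rfl

/-! The three meromorphic functions whose residues give the three identities. -/

/-- `sinh τz / (sinh βz cosh² βz sin πz)` -/
noncomputable def ceFun (β τ : ℝ) (z : ℂ) : ℂ :=
  Complex.sinh (τ * z) / (Complex.sinh (β * z) * Complex.cosh (β * z) ^ 2 * Complex.sin (π * z))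

/-- `cosh τz / (sinh βz cosh² βz cos πz)` -/
noncomputable def cfFun (β τ : ℝ) (z : ℂ) : ℂ :=
  Complex.cosh (τ * z) / (Complex.sinh (β * z) * Complex.cosh (β * z) ^ 2 * Complex.cos (π * z))

/-- `cosh τz / (cosh βz sinh² βz sin πz)` -/
noncomputable def cgFun (β τ : ℝ) (z : ℂ) : ℂ :=
  Complex.cosh (τ * z) / (Complex.cosh (β * z) * Complex.sinh (β * z) ^ 2 * Complex.sin (π * z))

/-! ### Residues of the three functions at all their poles -/

section Residues

variable {β τ : ℝ}

theorem complex_sinh_ne_zero {x : ℝ} (hβ : β ≠ 0) (hx : x ≠ 0) : Complex.sinh (β * x) ≠ 0 := by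
  rw [← Complex.ofReal_mul, ← Complex.ofReal_sinh]
  exact_mod_cast fun h => (mul_ne_zero hβ hx) (sinh_eq_zero.1 h)

theorem complex_cosh_ne_zero (x : ℝ) : Complex.cosh (β * x) ≠ 0 := by
  rw [← Complex.ofReal_mul, ← Complex.ofReal_cosh]
  exact_mod_cast (cosh_pos _).ne'

/-- Here and below `ε` is the sign `(-1)^n` or `(-1)^(n+1)` of the series term; `ε ^ 2 = 1` moves it
from the denominator to the numerator. -/
theorem hasResidue_ceFun_real (hβ : β ≠ 0) {x ε : ℝ} (hx : x ≠ 0) (hs : sin (π * x) = 0)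
    (hc : cos (π * x) = ε) (hε : ε ^ 2 = 1) : HasResidue (ceFun β τ) x
      ((1 / π * (ε * sinh (τ * x) / (sinh (β * x) * cosh (β * x) ^ 2)) : ℝ) : ℂ) := by
  have hε0 : ε ≠ 0 := by rintro rfl; norm_num at hε
  have hs' : Complex.sin (π * x) = 0 := by exact_mod_cast congrArg ((↑) : ℝ → ℂ) hs
  have hc' : Complex.cos (π * x) = ε := by exact_mod_cast congrArg ((↑) : ℝ → ℂ) hc
  have hε1 : (ε : ℂ) ^ 2 = 1 := by exact_mod_cast hε
  have hε2 : (ε : ℂ) ≠ 0 := by exact_mod_cast hε0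
  have hpi : (π : ℂ) ≠ 0 := by exact_mod_cast pi_ne_zero
  have h1 := complex_sinh_ne_zero hβ hx
  have h2 := complex_cosh_ne_zero (β := β) x
  convert hasResidue_zero_trig (hasDerivAt_sinh_mul τ x).continuousAt
    (hasDerivAt_sinh_mul β x).continuousAt (hasDerivAt_cosh_mul β x).continuousAt
    (hasDerivAt_sin_mul π x) h1 h2 hs' (by rw [hc']; exact mul_ne_zero hε2 hpi) using 1
  · rfl
  · rw [hc']
    push_cast
    generalize Complex.sinh (β * x) = s at h1
    generalize Complex.cosh (β * x) = c at h2
    field_simp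
    linear_combination Complex.sinh (τ * x) * hε1

theorem hasResidue_cfFun_real (hβ : β ≠ 0) {x ε : ℝ} (hx : x ≠ 0) (hs : sin (π * x) = -ε)
    (hc : cos (π * x) = 0) (hε : ε ^ 2 = 1) : HasResidue (cfFun β τ) x
      ((1 / π * (ε * cosh (τ * x) / (sinh (β * x) * cosh (β * x) ^ 2)) : ℝ) : ℂ) := by
  have hε0 : ε ≠ 0 := by rintro rfl; norm_num at hε
  have hs' : Complex.sin (π * x) = -ε := by exact_mod_cast congrArg ((↑) : ℝ → ℂ) hs
  have hc' : Complex.cos (π * x) = 0 := by exact_mod_cast congrArg ((↑) : ℝ → ℂ) hc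
  have hε1 : (ε : ℂ) ^ 2 = 1 := by exact_mod_cast hε
  have hε2 : (ε : ℂ) ≠ 0 := by exact_mod_cast hε0
  have hpi : (π : ℂ) ≠ 0 := by exact_mod_cast pi_ne_zero
  have h1 := complex_sinh_ne_zero hβ hx
  have h2 := complex_cosh_ne_zero (β := β) x
  convert hasResidue_zero_trig (hasDerivAt_cosh_mul τ x).continuousAt
    (hasDerivAt_sinh_mul β x).continuousAt (hasDerivAt_cosh_mul β x).continuousAt
    (hasDerivAt_cos_mul π x) h1 h2 hc' (by rw [hs', neg_neg]; exact mul_ne_zero hε2 hpi) using 1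
  · rfl
  · rw [hs']
    push_cast
    generalize Complex.sinh (β * x) = s at h1
    generalize Complex.cosh (β * x) = c at h2
    field_simp
    linear_combination Complex.cosh (τ * x) * hε1

theorem hasResidue_cgFun_real (hβ : β ≠ 0) {x ε : ℝ} (hx : x ≠ 0) (hs : sin (π * x) = 0)
    (hc : cos (π * x) = ε) (hε : ε ^ 2 = 1) : HasResidue (cgFun β τ) x
      ((1 / π * (ε * cosh (τ * x) / (cosh (β * x) * sinh (β * x) ^ 2)) : ℝ) : ℂ) := by
  have hε0 : ε ≠ 0 := by rintro rfl; norm_num at hε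
  have hs' : Complex.sin (π * x) = 0 := by exact_mod_cast congrArg ((↑) : ℝ → ℂ) hs
  have hc' : Complex.cos (π * x) = ε := by exact_mod_cast congrArg ((↑) : ℝ → ℂ) hc
  have hε1 : (ε : ℂ) ^ 2 = 1 := by exact_mod_cast hε
  have hε2 : (ε : ℂ) ≠ 0 := by exact_mod_cast hε0
  have hpi : (π : ℂ) ≠ 0 := by exact_mod_cast pi_ne_zero
  have h1 := complex_sinh_ne_zero hβ hx
  have h2 := complex_cosh_ne_zero (β := β) x
  convert hasResidue_zero_trig (hasDerivAt_cosh_mul τ x).continuousAt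
    (hasDerivAt_cosh_mul β x).continuousAt (hasDerivAt_sinh_mul β x).continuousAt
    (hasDerivAt_sin_mul π x) h2 h1 hs' (by rw [hc']; exact mul_ne_zero hε2 hpi) using 1
  · rfl
  · rw [hc']
    push_cast
    generalize Complex.sinh (β * x) = s at h1
    generalize Complex.cosh (β * x) = c at h2
    field_simp
    linear_combination Complex.cosh (τ * x) * hε1

theorem sinh_pi_mul_ne_zero {y : ℝ} (hy : y ≠ 0) : ((sinh (π * y) : ℝ) : ℂ) ≠ 0 := by
  exact_mod_cast fun h => (mul_ne_zero pi_ne_zero hy) (sinh_eq_zero.1 h)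

theorem cosh_pi_mul_ne_zero (y : ℝ) : ((cosh (π * y) : ℝ) : ℂ) ≠ 0 := by
  exact_mod_cast (cosh_pos _).ne'

theorem ofReal_facts {ε : ℝ} (hε : ε ^ 2 = 1) : (ε : ℂ) ≠ 0 ∧ (ε : ℂ) ^ 2 = 1 := by
  refine ⟨?_, by exact_mod_cast hε⟩
  rintro h
  rw [Complex.ofReal_eq_zero] at h
  subst h
  norm_num at hε

theorem hasResidue_ceFun_simple (hβ : β ≠ 0) {y ε : ℝ} (hy : y ≠ 0) (hs : sin (β * y) = 0)
    (hc : cos (β * y) = ε) (hε : ε ^ 2 = 1) : HasResidue (ceFun β τ) (y * Complex.I)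
      ((1 / β * (ε * sin (τ * y) / sinh (π * y)) : ℝ) : ℂ) := by
  obtain ⟨hε0, hε1⟩ := ofReal_facts hε
  have hβ' : (β : ℂ) ≠ 0 := by exact_mod_cast hβ
  have hS := sinh_pi_mul_ne_zero hy
  convert hasResidue_zero_simple (N := fun z => Complex.sinh (τ * z))
    (S := fun z => Complex.sin (π * z)) (hasDerivAt_sinh_mul τ _).continuousAt
    (hasDerivAt_sinh_mul β (y * Complex.I)) (hasDerivAt_cosh_mul β _).continuousAt
    (hasDerivAt_sin_mul π _).continuousAt ?_ ?_ ?_ ?_ using 1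
  · rfl
  · simp only [sinh_mul_mul_I, cosh_mul_mul_I, sin_mul_mul_I, hc]
    generalize sin (τ * y) = u
    generalize sinh (π * y) = s at hS
    push_cast
    field_simp
    -- The residue carries `1 / ε ^ 3`, and `ε ^ 4 - 1 = (ε ^ 2 + 1)(ε ^ 2 - 1)` replaces it by `ε`.
    linear_combination (u : ℂ) * ((ε : ℂ) ^ 2 + 1) * hε1
  · rw [sinh_mul_mul_I, hs]; simp
  · rw [cosh_mul_mul_I, hc]; exact hε0
  · rw [sin_mul_mul_I]; exact mul_ne_zero hS Complex.I_ne_zero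
  · rw [cosh_mul_mul_I, hc]; exact mul_ne_zero hε0 hβ'

theorem hasResidue_cfFun_simple (hβ : β ≠ 0) {y ε : ℝ} (hs : sin (β * y) = 0)
    (hc : cos (β * y) = ε) (hε : ε ^ 2 = 1) : HasResidue (cfFun β τ) (y * Complex.I)
      ((1 / β * (ε * cos (τ * y) / cosh (π * y)) : ℝ) : ℂ) := by
  obtain ⟨hε0, hε1⟩ := ofReal_facts hε
  have hβ' : (β : ℂ) ≠ 0 := by exact_mod_cast hβ
  have hS := cosh_pi_mul_ne_zero y
  convert hasResidue_zero_simple (N := fun z => Complex.cosh (τ * z))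
    (S := fun z => Complex.cos (π * z)) (hasDerivAt_cosh_mul τ _).continuousAt
    (hasDerivAt_sinh_mul β (y * Complex.I)) (hasDerivAt_cosh_mul β _).continuousAt
    (hasDerivAt_cos_mul π _).continuousAt ?_ ?_ ?_ ?_ using 1
  · rfl
  · simp only [cosh_mul_mul_I, cos_mul_mul_I, hc]
    generalize cos (τ * y) = u
    generalize cosh (π * y) = s at hS
    push_cast
    field_simp
    linear_combination (u : ℂ) * ((ε : ℂ) ^ 2 + 1) * hε1
  · rw [sinh_mul_mul_I, hs]; simp
  · rw [cosh_mul_mul_I, hc]; exact hε0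
  · rw [cos_mul_mul_I]; exact hS
  · rw [cosh_mul_mul_I, hc]; exact mul_ne_zero hε0 hβ'

theorem hasResidue_cgFun_simple (hβ : β ≠ 0) {y ε : ℝ} (hy : y ≠ 0) (hs : sin (β * y) = ε)
    (hc : cos (β * y) = 0) (hε : ε ^ 2 = 1) : HasResidue (cgFun β τ) (y * Complex.I)
      ((1 / β * (ε * cos (τ * y) / sinh (π * y)) : ℝ) : ℂ) := by
  obtain ⟨hε0, hε1⟩ := ofReal_facts hε
  have hβ' : (β : ℂ) ≠ 0 := by exact_mod_cast hβ
  have hS := sinh_pi_mul_ne_zero hy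
  have hI := Complex.I_ne_zero
  convert hasResidue_zero_simple (N := fun z => Complex.cosh (τ * z))
    (S := fun z => Complex.sin (π * z)) (hasDerivAt_cosh_mul τ _).continuousAt
    (hasDerivAt_cosh_mul β (y * Complex.I)) (hasDerivAt_sinh_mul β _).continuousAt
    (hasDerivAt_sin_mul π _).continuousAt ?_ ?_ ?_ ?_ using 1
  · rfl
  · simp only [sinh_mul_mul_I, cosh_mul_mul_I, sin_mul_mul_I, hs]
    generalize cos (τ * y) = u
    generalize sinh (π * y) = s at hS
    push_cast
    field_simp
    rw [Complex.I_pow_four]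
    linear_combination (u : ℂ) * ((ε : ℂ) ^ 2 + 1) * hε1
  · rw [cosh_mul_mul_I, hc]; simp
  · rw [sinh_mul_mul_I, hs]; exact mul_ne_zero hε0 hI
  · rw [sin_mul_mul_I]; exact mul_ne_zero hS hI
  · rw [sinh_mul_mul_I, hs]; exact mul_ne_zero (mul_ne_zero hε0 hI) hβ'

/-- Differentiating `N / S` gives the two terms: `N'` yields the one with `τ`, and `S'` the one with
`π` and the squared denominator. -/
theorem hasResidue_ceFun_double (hβ : β ≠ 0) {y ε : ℝ} (hy : y ≠ 0) (hs : sin (β * y) = -ε)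
    (hc : cos (β * y) = 0) (hε : ε ^ 2 = 1) : HasResidue (ceFun β τ) (y * Complex.I)
      ((-(τ / β ^ 2) * (ε * cos (τ * y) / sinh (π * y)) +
        π / β ^ 2 * (ε * sin (τ * y) * cosh (π * y) / sinh (π * y) ^ 2) : ℝ) : ℂ) := by
  obtain ⟨hε0, hε1⟩ := ofReal_facts hε
  have hβ' : (β : ℂ) ≠ 0 := by exact_mod_cast hβ
  have hS := sinh_pi_mul_ne_zero hy
  have hI := Complex.I_ne_zero
  have hA : HasDerivAt (fun z : ℂ => Complex.sinh (β * z)) 0 (y * Complex.I) := by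
    have := hasDerivAt_sinh_mul β (y * Complex.I)
    rwa [cosh_mul_mul_I, hc, Complex.ofReal_zero, zero_mul] at this
  convert hasResidue_zero_double (hasDerivAt_sinh_mul τ (y * Complex.I)) hA
    (hasDerivAt_sin_mul π (y * Complex.I))
    (cosh_linear_at_zero (β := β) (by rw [cosh_mul_mul_I, hc, Complex.ofReal_zero])) ?_ ?_ ?_ using 1
  · rfl
  · simp only [sinh_mul_mul_I, cosh_mul_mul_I, sin_mul_mul_I, cos_mul_mul_I, hs]
    generalize sin (τ * y) = u
    generalize cos (τ * y) = v
    generalize sinh (π * y) = s at hS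
    generalize cosh (π * y) = c
    push_cast
    field_simp
    rw [Complex.I_pow_four]
    linear_combination (-(τ * v * s - π * u * c : ℂ)) * ((ε : ℂ) ^ 2 + 1) * hε1
  · rw [sinh_mul_mul_I, hs]; push_cast; exact mul_ne_zero (neg_ne_zero.2 hε0) hI
  · rw [sin_mul_mul_I]; exact mul_ne_zero hS hI
  · rw [sinh_mul_mul_I, hs]; push_cast; exact mul_ne_zero (mul_ne_zero (neg_ne_zero.2 hε0) hI) hβ'

theorem hasResidue_cfFun_double (hβ : β ≠ 0) {y ε : ℝ} (hs : sin (β * y) = -ε)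
    (hc : cos (β * y) = 0) (hε : ε ^ 2 = 1) : HasResidue (cfFun β τ) (y * Complex.I)
      ((τ / β ^ 2 * (ε * sin (τ * y) / cosh (π * y)) +
        π / β ^ 2 * (ε * cos (τ * y) * sinh (π * y) / cosh (π * y) ^ 2) : ℝ) : ℂ) := by
  obtain ⟨hε0, hε1⟩ := ofReal_facts hε
  have hβ' : (β : ℂ) ≠ 0 := by exact_mod_cast hβ
  have hS := cosh_pi_mul_ne_zero y
  have hI := Complex.I_ne_zero
  have hA : HasDerivAt (fun z : ℂ => Complex.sinh (β * z)) 0 (y * Complex.I) := by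
    have := hasDerivAt_sinh_mul β (y * Complex.I)
    rwa [cosh_mul_mul_I, hc, Complex.ofReal_zero, zero_mul] at this
  convert hasResidue_zero_double (hasDerivAt_cosh_mul τ (y * Complex.I)) hA
    (hasDerivAt_cos_mul π (y * Complex.I))
    (cosh_linear_at_zero (β := β) (by rw [cosh_mul_mul_I, hc, Complex.ofReal_zero])) ?_ ?_ ?_ using 1
  · rfl
  · simp only [sinh_mul_mul_I, cosh_mul_mul_I, sin_mul_mul_I, cos_mul_mul_I, hs]
    generalize sin (τ * y) = u
    generalize cos (τ * y) = v
    generalize sinh (π * y) = s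
    generalize cosh (π * y) = c at hS
    push_cast
    field_simp
    rw [Complex.I_sq]
    linear_combination (-(τ * u * c + π * v * s : ℂ)) * ((ε : ℂ) ^ 2 + 1) * hε1
  · rw [sinh_mul_mul_I, hs]; push_cast; exact mul_ne_zero (neg_ne_zero.2 hε0) hI
  · rw [cos_mul_mul_I]; exact hS
  · rw [sinh_mul_mul_I, hs]; push_cast; exact mul_ne_zero (mul_ne_zero (neg_ne_zero.2 hε0) hI) hβ'

theorem hasResidue_cgFun_double (hβ : β ≠ 0) {y ε : ℝ} (hy : y ≠ 0) (hs : sin (β * y) = 0)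
    (hc : cos (β * y) = ε) (hε : ε ^ 2 = 1) : HasResidue (cgFun β τ) (y * Complex.I)
      ((τ / β ^ 2 * (ε * sin (τ * y) / sinh (π * y)) +
        π / β ^ 2 * (ε * cos (τ * y) * cosh (π * y) / sinh (π * y) ^ 2) : ℝ) : ℂ) := by
  obtain ⟨hε0, hε1⟩ := ofReal_facts hε
  have hβ' : (β : ℂ) ≠ 0 := by exact_mod_cast hβ
  have hS := sinh_pi_mul_ne_zero hy
  have hI := Complex.I_ne_zero
  have hA : HasDerivAt (fun z : ℂ => Complex.cosh (β * z)) 0 (y * Complex.I) := by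
    have := hasDerivAt_cosh_mul β (y * Complex.I)
    rwa [sinh_mul_mul_I, hs, Complex.ofReal_zero, zero_mul, zero_mul] at this
  convert hasResidue_zero_double (hasDerivAt_cosh_mul τ (y * Complex.I)) hA
    (hasDerivAt_sin_mul π (y * Complex.I))
    (sinh_linear_at_zero (β := β) (by rw [sinh_mul_mul_I, hs, Complex.ofReal_zero, zero_mul]))
    ?_ ?_ ?_ using 1
  · rfl
  · simp only [sinh_mul_mul_I, cosh_mul_mul_I, sin_mul_mul_I, cos_mul_mul_I, hc]
    generalize sin (τ * y) = u
    generalize cos (τ * y) = v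
    generalize sinh (π * y) = s at hS
    generalize cosh (π * y) = c
    push_cast
    field_simp
    rw [Complex.I_sq]
    linear_combination (-(τ * u * s + π * v * c : ℂ)) * ((ε : ℂ) ^ 2 + 1) * hε1
  · rw [cosh_mul_mul_I, hc]; exact hε0
  · rw [sin_mul_mul_I]; exact mul_ne_zero hS hI
  · rw [cosh_mul_mul_I, hc]; exact mul_ne_zero hε0 hβ'

/-- The zero of `sinh τz` cancels one of the two zeros of the denominator, so a simple-pole limit
suffices. -/
theorem hasResidue_ceFun_zero (hβ : β ≠ 0) :
    HasResidue (ceFun β τ) 0 ((τ / (β * π) : ℝ) : ℂ) := by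
  have hβ' : (β : ℂ) ≠ 0 := by exact_mod_cast hβ
  have hpi : (π : ℂ) ≠ 0 := by exact_mod_cast pi_ne_zero
  refine hasResidue_of_tendsto ?_
  have h1 := tendsto_div_sub_of_hasDerivAt (hasDerivAt_sinh_mul τ 0) (by simp)
  have h2 := tendsto_div_sub_of_hasDerivAt (hasDerivAt_sinh_mul β 0) (by simp)
  have h3 := tendsto_div_sub_of_hasDerivAt (hasDerivAt_sin_mul π 0) (by simp)
  have h4 : Tendsto _ (𝓝[≠] (0 : ℂ)) _ :=
    (hasDerivAt_cosh_mul β 0).continuousAt.tendsto.mono_left nhdsWithin_le_nhds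
  simp only [mul_zero, Complex.cosh_zero, Complex.cos_zero, one_mul] at h1 h2 h3 h4
  have h5 := h1.div ((h2.mul h3).mul (h4.pow 2)) (by simp [hβ, pi_ne_zero])
  rw [one_pow, mul_one] at h5
  push_cast
  refine h5.congr' ?_
  filter_upwards [self_mem_nhdsWithin] with z hz
  have hz' : z ≠ 0 := hz
  simp only [Pi.div_apply, sub_zero, ceFun]
  field_simp

theorem hasResidue_cfFun_zero (hβ : β ≠ 0) : HasResidue (cfFun β τ) 0 ((1 / β : ℝ) : ℂ) := by
  have h := hasResidue_cfFun_simple (β := β) (τ := τ) (y := 0) (ε := 1) hβ (by simp) (by simp)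
    (by norm_num)
  simpa using h

/-- The numerator is `1 + τ² h²/2 + …`, and the denominator is `πβ² h³ (1 + (β²/2 + β²/3 - π²/6) h²
+ …)`; the residue is the `h²` coefficient of the quotient after removing `h³`. -/
theorem hasResidue_cgFun_zero (hβ : β ≠ 0) : HasResidue (cgFun β τ) 0
    ((1 / (π * β ^ 2) * (τ ^ 2 / 2 - 5 * β ^ 2 / 6 + π ^ 2 / 6) : ℝ) : ℂ) := by
  have hβ' : (β : ℂ) ≠ 0 := by exact_mod_cast hβ
  have hpi : (π : ℂ) ≠ 0 := by exact_mod_cast pi_ne_zero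
  have hN : EvenExpansion _ _ _ := cosh_mul_expansion τ
  have hA : EvenExpansion _ _ _ := cosh_mul_expansion β
  have hB : EvenExpansion _ _ _ := sinh_mul_expansion β
  have hS : EvenExpansion _ _ _ := sin_mul_expansion π
  have h := hN.div ((hA.mul (hB.mul hB)).mul hS) (by simp [hβ, pi_ne_zero])
  convert hasResidue_triple h (F := cgFun β τ) ?_ using 1
  · push_cast
    field_simp
    ring
  · filter_upwards [self_mem_nhdsWithin] with z hz
    have hz' : z ≠ 0 := hz
    simp only [cgFun]
    field_simp

end Residues

/-! ### Assembly of the three identities -/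

theorem cos_sin_pi_succ (n : ℕ) : cos (π * (n + 1)) = (-1) ^ (n + 1) ∧ sin (π * (n + 1)) = 0 := by
  have e : π * ((n : ℝ) + 1) = ((n + 1 : ℕ) : ℝ) * π := by push_cast; ring
  rw [e]
  exact ⟨cos_nat_mul_pi _, sin_nat_mul_pi _⟩

theorem cos_sin_pi_half (n : ℕ) :
    cos (π * (n + 1 / 2)) = 0 ∧ sin (π * (n + 1 / 2)) = -(-1) ^ (n + 1) := by
  have e : π * ((n : ℝ) + 1 / 2) = n * π + π / 2 := by ring
  rw [e, cos_add_pi_div_two, sin_add_pi_div_two, sin_nat_mul_pi, cos_nat_mul_pi]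
  exact ⟨neg_zero, by ring⟩

theorem neg_one_pow_sq (n : ℕ) : ((-1 : ℝ) ^ n) ^ 2 = 1 := by
  rw [← pow_mul, mul_comm, pow_mul]; simp

section Identities

variable {a b θ : ℝ}

theorem hasSum_ofReal_mul {f : ℕ → ℝ} (hf : ConvFromOne f) (c : ℝ) :
    HasSum (fun n => ((c * f (n + 1) : ℝ) : ℂ)) ((c * sumFromOne f : ℝ) : ℂ) :=
  Complex.hasSum_ofReal.2 ((Summable.hasSum hf).mul_left c)

theorem hasSum_ofReal_mul_add {f g : ℕ → ℝ} (hf : ConvFromOne f) (hg : ConvFromOne g) (c d : ℝ) :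
    HasSum (fun n => ((c * f (n + 1) + d * g (n + 1) : ℝ) : ℂ))
      ((c * sumFromOne f + d * sumFromOne g : ℝ) : ℂ) :=
  Complex.hasSum_ofReal.2 (((Summable.hasSum hf).mul_left c).add ((Summable.hasSum hg).mul_left d))

/-- The ordinates of the poles on the imaginary axis. -/
theorem grid_half (ha : a ≠ 0) (hb : b ≠ 0) (n : ℕ) :
    (2 * (n : ℝ) + 1) * (π / (2 * (b * π / a))) ≠ 0 ∧
      b * π / a * ((2 * n + 1) * (π / (2 * (b * π / a)))) = π * (n + 1 / 2) ∧
      θ / a * ((2 * n + 1) * (π / (2 * (b * π / a)))) = θ / b * (n + 1 / 2) ∧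
      π * ((2 * n + 1) * (π / (2 * (b * π / a)))) = a * π / b * (n + 1 / 2) := by
  have := pi_ne_zero
  refine ⟨by positivity, ?_, ?_, ?_⟩ <;> field_simp

theorem grid_int (ha : a ≠ 0) (hb : b ≠ 0) (n : ℕ) :
    (2 * (n : ℝ) + 2) * (π / (2 * (b * π / a))) ≠ 0 ∧
      b * π / a * ((2 * n + 2) * (π / (2 * (b * π / a)))) = π * (n + 1) ∧
      θ / a * ((2 * n + 2) * (π / (2 * (b * π / a)))) = θ / b * (n + 1) ∧
      π * ((2 * n + 2) * (π / (2 * (b * π / a)))) = a * π / b * (n + 1) := by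
  have := pi_ne_zero
  refine ⟨by positivity, ?_, ?_, ?_⟩ <;> field_simp

theorem ce_identity (ha : a ≠ 0) (hb : b ≠ 0) (hθ : |θ| < 3 * b * π) :
    b ^ 2 * π * sumFromOne (ceHyp a b θ) + a * b * π * sumFromOne (sinOverSinh a b θ)
      - a * θ * sumFromOne (ceCosOdd a b θ) + a ^ 2 * π * sumFromOne (ceSinOdd a b θ)
      + θ * b / 2 = 0 := by
  have hpi := pi_ne_zero
  have hβ : b * π / a ≠ 0 := by positivity
  have key := quotient_residue_sum hβ (abs_div_lt_of_abs_lt ha hθ) (Or.inl rfl)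
    (Or.inl ⟨rfl, rfl⟩) (Or.inl ⟨rfl, rfl⟩) (fun z => ?_) (hasResidue_ceFun_zero hβ)
    (rx := fun n => ((1 / π * ceHyp a b θ (n + 1) : ℝ) : ℂ))
    (re := fun n => ((-(θ / a / (b * π / a) ^ 2) * ceCosOdd a b θ (n + 1) +
        π / (b * π / a) ^ 2 * ceSinOdd a b θ (n + 1) : ℝ) : ℂ))
    (ro := fun n => ((1 / (b * π / a) * sinOverSinh a b θ (n + 1) : ℝ) : ℂ))
    (fun n => ?_) (fun n => ?_) (fun n => ?_)
    (hasSum_ofReal_mul (convFromOne_ceHyp ha hb hθ) _)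
    (hasSum_ofReal_mul_add (convFromOne_ceCosOdd ha hb) (convFromOne_ceSinOdd ha hb) _ _)
    (hasSum_ofReal_mul (convFromOne_sinOverSinh ha hb) _)
  · norm_cast at key
    -- The identity is `b²π²/2` times the residue relation.
    field_simp at key
    linear_combination (1 / 2) * key
  · simp only [mul_neg, Complex.sinh_neg, Complex.cosh_neg, Complex.sin_neg]
    ring
  · have h := hasResidue_ceFun_real (τ := θ / a) hβ (x := n + 1) (by positivity)
      (cos_sin_pi_succ n).2 (cos_sin_pi_succ n).1 (neg_one_pow_sq _)
    rw [← ceHyp_succ] at h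
    convert h using 1
    · rfl
    · push_cast
      ring
  · obtain ⟨h0, h1, h2, h3⟩ := grid_half (θ := θ) ha hb n
    have h := hasResidue_ceFun_double (τ := θ / a) hβ h0 (by rw [h1]; exact (cos_sin_pi_half n).2)
      (by rw [h1]; exact (cos_sin_pi_half n).1) (neg_one_pow_sq _)
    rw [h2, h3, ← ceCosOdd_succ, ← ceSinOdd_succ] at h
    exact h
  · obtain ⟨h0, h1, h2, h3⟩ := grid_int (θ := θ) ha hb n
    have h := hasResidue_ceFun_simple (τ := θ / a) hβ h0 (by rw [h1]; exact (cos_sin_pi_succ n).2)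
      (by rw [h1]; exact (cos_sin_pi_succ n).1) (neg_one_pow_sq _)
    rw [h2, h3, ← sinOverSinh_succ] at h
    exact h

theorem cf_identity (ha : a ≠ 0) (hb : b ≠ 0) (hθ : |θ| < 3 * b * π) :
    b ^ 2 * π * sumFromOne (cfHyp a b θ) + a * θ * sumFromOne (cfSinOdd a b θ)
      + a ^ 2 * π * sumFromOne (cfCosOdd a b θ) + a * b * π * sumFromOne (cfCos a b θ)
      + a * b * π / 2 = 0 := by
  have hpi := pi_ne_zero
  have hβ : b * π / a ≠ 0 := by positivity
  have key := quotient_residue_sum hβ (abs_div_lt_of_abs_lt ha hθ) (Or.inr rfl)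
    (Or.inl ⟨rfl, rfl⟩) (Or.inr ⟨rfl, rfl⟩) (fun z => ?_) (hasResidue_cfFun_zero hβ)
    (rx := fun n => ((1 / π * cfHyp a b θ (n + 1) : ℝ) : ℂ))
    (re := fun n => ((θ / a / (b * π / a) ^ 2 * cfSinOdd a b θ (n + 1) +
        π / (b * π / a) ^ 2 * cfCosOdd a b θ (n + 1) : ℝ) : ℂ))
    (ro := fun n => ((1 / (b * π / a) * cfCos a b θ (n + 1) : ℝ) : ℂ))
    (fun n => ?_) (fun n => ?_) (fun n => ?_)
    (hasSum_ofReal_mul (convFromOne_cfHyp ha hb hθ) _)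
    (hasSum_ofReal_mul_add (convFromOne_cfSinOdd ha hb) (convFromOne_cfCosOdd ha hb) _ _)
    (hasSum_ofReal_mul (convFromOne_cfCos ha hb) _)
  · norm_cast at key
    field_simp at key
    linear_combination (1 / 2) * key
  · simp only [mul_neg, Complex.sinh_neg, Complex.cosh_neg, Complex.cos_neg]
    ring
  · have h := hasResidue_cfFun_real (τ := θ / a) hβ (x := n + 1 / 2) (by positivity)
      (cos_sin_pi_half n).2 (cos_sin_pi_half n).1 (neg_one_pow_sq _)
    rw [← cfHyp_succ] at h
    convert h using 1
    · rfl
    · push_cast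
      ring
  · obtain ⟨-, h1, h2, h3⟩ := grid_half (θ := θ) ha hb n
    have h := hasResidue_cfFun_double (τ := θ / a) hβ (by rw [h1]; exact (cos_sin_pi_half n).2)
      (by rw [h1]; exact (cos_sin_pi_half n).1) (neg_one_pow_sq _)
    rw [h2, h3, ← cfSinOdd_succ, ← cfCosOdd_succ] at h
    exact h
  · obtain ⟨-, h1, h2, h3⟩ := grid_int (θ := θ) ha hb n
    have h := hasResidue_cfFun_simple (τ := θ / a) hβ (by rw [h1]; exact (cos_sin_pi_succ n).2)
      (by rw [h1]; exact (cos_sin_pi_succ n).1) (neg_one_pow_sq _)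
    rw [h2, h3, ← cfCos_succ] at h
    exact h

theorem cg_identity (ha : a ≠ 0) (hb : b ≠ 0) (hθ : |θ| < 3 * b * π) :
    b ^ 2 * π ^ 2 * sumFromOne (cgHyp a b θ) + a * π * θ * sumFromOne (sinOverSinh a b θ)
      + a ^ 2 * π ^ 2 * sumFromOne (cgCos a b θ) + a * b * π ^ 2 * sumFromOne (cgCosOdd a b θ)
      + (a ^ 2 * π ^ 2 - 5 * b ^ 2 * π ^ 2 + 3 * θ ^ 2) / 12 = 0 := by
  have hpi := pi_ne_zero
  have hβ : b * π / a ≠ 0 := by positivity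
  have key := quotient_residue_sum hβ (abs_div_lt_of_abs_lt ha hθ) (Or.inr rfl)
    (Or.inr ⟨rfl, rfl⟩) (Or.inl ⟨rfl, rfl⟩) (fun z => ?_) (hasResidue_cgFun_zero hβ)
    (rx := fun n => ((1 / π * cgHyp a b θ (n + 1) : ℝ) : ℂ))
    -- Here `sinh` is the squared factor, so the double poles sit at the even nodes and the odd
    -- nodes are simple.
    (re := fun n => ((1 / (b * π / a) * cgCosOdd a b θ (n + 1) : ℝ) : ℂ))
    (ro := fun n => ((θ / a / (b * π / a) ^ 2 * sinOverSinh a b θ (n + 1) +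
        π / (b * π / a) ^ 2 * cgCos a b θ (n + 1) : ℝ) : ℂ))
    (fun n => ?_) (fun n => ?_) (fun n => ?_)
    (hasSum_ofReal_mul (convFromOne_cgHyp ha hb hθ) _)
    (hasSum_ofReal_mul (convFromOne_cgCosOdd ha hb) _)
    (hasSum_ofReal_mul_add (convFromOne_sinOverSinh ha hb) (convFromOne_cgCos ha hb) _ _)
  · norm_cast at key
    -- The identity is `b²π³/2` times the residue relation.
    field_simp at key
    linear_combination (1 / 24) * key
  · simp only [mul_neg, Complex.sinh_neg, Complex.cosh_neg, Complex.sin_neg]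
    ring
  · have h := hasResidue_cgFun_real (τ := θ / a) hβ (x := n + 1) (by positivity)
      (cos_sin_pi_succ n).2 (cos_sin_pi_succ n).1 (neg_one_pow_sq _)
    rw [← cgHyp_succ] at h
    convert h using 1
    · rfl
    · push_cast
      ring
  · obtain ⟨h0, h1, h2, h3⟩ := grid_half (θ := θ) ha hb n
    -- At these ordinates `sin (βy) = sin (π(n + 1/2)) = (-1)^n`, which is the sign `(-1)^(n-1)` of
    -- `cgCosOdd` after the index shift.
    have h := hasResidue_cgFun_simple (τ := θ / a) (ε := (-1) ^ n) hβ h0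
      (by rw [h1, (cos_sin_pi_half n).2]; ring)
      (by rw [h1]; exact (cos_sin_pi_half n).1) (neg_one_pow_sq _)
    rw [h2, h3, ← cgCosOdd_succ] at h
    exact h
  · obtain ⟨h0, h1, h2, h3⟩ := grid_int (θ := θ) ha hb n
    have h := hasResidue_cgFun_double (τ := θ / a) hβ h0 (by rw [h1]; exact (cos_sin_pi_succ n).2)
      (by rw [h1]; exact (cos_sin_pi_succ n).1) (neg_one_pow_sq _)
    rw [h2, h3, ← sinOverSinh_succ, ← cgCos_succ] at h
    exact h

end Identities

end HypSeries

theorem mainTheorem4 (a b θ : ℝ) (ha : a ≠ 0) (hb : b ≠ 0) (hθ : |θ| < 3 * b * π) :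
    ((HypSeries.ConvFromOne (HypSeries.ceHyp a b θ) ∧
        HypSeries.ConvFromOne (HypSeries.sinOverSinh a b θ) ∧
        HypSeries.ConvFromOne (HypSeries.ceCosOdd a b θ) ∧
        HypSeries.ConvFromOne (HypSeries.ceSinOdd a b θ)) ∧
      b ^ 2 * π * HypSeries.sumFromOne (HypSeries.ceHyp a b θ)
        + a * b * π * HypSeries.sumFromOne (HypSeries.sinOverSinh a b θ)
        - a * θ * HypSeries.sumFromOne (HypSeries.ceCosOdd a b θ)
        + a ^ 2 * π * HypSeries.sumFromOne (HypSeries.ceSinOdd a b θ)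
        + θ * b / 2 = 0) ∧
    ((HypSeries.ConvFromOne (HypSeries.cfHyp a b θ) ∧
        HypSeries.ConvFromOne (HypSeries.cfSinOdd a b θ) ∧
        HypSeries.ConvFromOne (HypSeries.cfCosOdd a b θ) ∧
        HypSeries.ConvFromOne (HypSeries.cfCos a b θ)) ∧
      b ^ 2 * π * HypSeries.sumFromOne (HypSeries.cfHyp a b θ)
        + a * θ * HypSeries.sumFromOne (HypSeries.cfSinOdd a b θ)
        + a ^ 2 * π * HypSeries.sumFromOne (HypSeries.cfCosOdd a b θ)
        + a * b * π * HypSeries.sumFromOne (HypSeries.cfCos a b θ)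
        + a * b * π / 2 = 0) ∧
    ((HypSeries.ConvFromOne (HypSeries.cgHyp a b θ) ∧
        HypSeries.ConvFromOne (HypSeries.sinOverSinh a b θ) ∧
        HypSeries.ConvFromOne (HypSeries.cgCos a b θ) ∧
        HypSeries.ConvFromOne (HypSeries.cgCosOdd a b θ)) ∧
      b ^ 2 * π ^ 2 * HypSeries.sumFromOne (HypSeries.cgHyp a b θ)
        + a * π * θ * HypSeries.sumFromOne (HypSeries.sinOverSinh a b θ)
        + a ^ 2 * π ^ 2 * HypSeries.sumFromOne (HypSeries.cgCos a b θ)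
        + a * b * π ^ 2 * HypSeries.sumFromOne (HypSeries.cgCosOdd a b θ)
        + (a ^ 2 * π ^ 2 - 5 * b ^ 2 * π ^ 2 + 3 * θ ^ 2) / 12 = 0) := by
  exact ⟨⟨⟨HypSeries.convFromOne_ceHyp ha hb hθ, HypSeries.convFromOne_sinOverSinh ha hb, HypSeries.convFromOne_ceCosOdd ha hb,
      HypSeries.convFromOne_ceSinOdd ha hb⟩, HypSeries.ce_identity ha hb hθ⟩,
    ⟨⟨HypSeries.convFromOne_cfHyp ha hb hθ, HypSeries.convFromOne_cfSinOdd ha hb,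
      HypSeries.convFromOne_cfCosOdd ha hb, HypSeries.convFromOne_cfCos ha hb⟩,
      HypSeries.cf_identity ha hb hθ⟩,
    ⟨⟨HypSeries.convFromOne_cgHyp ha hb hθ, HypSeries.convFromOne_sinOverSinh ha hb,
      HypSeries.convFromOne_cgCos ha hb, HypSeries.convFromOne_cgCosOdd ha hb⟩,
      HypSeries.cg_identity ha hb hθ⟩⟩
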